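/- For an integrable nonincreasing function $w:[0,\infty)\to[0,\infty)$, not identically zero, let $\|X\|_\infty=\sup\{x\ge 0: w(x)>0\}\in(0,\infty]$ be the right end point of its support and $h(x)=\int_x^\infty w(x')\,dx'$. If $h$ is $C^2$ on $[0,\|X\|_\infty)$, the beta function of $w$ is $\beta(x)=h''(x)h(x)/h'(x)^2$, $0\le x<\|X\|_\infty$. A solution of the Lifschitz-Slyozov-Wagner (LSW) system with initial data $w_0$ is a continuous function $w(x,t)\ge 0$ on $[0,\infty)\times[0,\infty)$, nonincreasing in $x$, with $w(\cdot,0)=w_0$, such that for all $t\ge 0$ $$\int_0^\infty w(x,t)\,dx=1,$$ and such that $w$ is differentiable and satisfies $$\frac{\partial w}{\partial t}(x,t)=\Big[1-\Big(\frac{x}{L(t)}\Big)^{1/3}\Big]\frac{\partial w}{\partial x}(x,t),\qquad L(t)^{1/3}=\frac13\int_0^\infty x^{-2/3}w(x,t)\,dx\Big/w(0,t),$$ at all points $x>0$, $t>0$ with $w(x,t)>0$. With $c(x,t)=-\partial w(x,t)/\partial x$, the mean cluster volume is $\Lambda(t)=\int_0^\infty x\,c(x,t)\,dx\big/\int_0^\infty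 c(x,t)\,dx$. Proposition 4.3. There is a universal constant $\beta_\infty>0$ with the following property. Let $w_0:[0,\infty)\to[0,\infty)$ be nonincreasing with $\int_0^\infty w_0(x)\,dx=1$, let $h_0(x)=\int_x^\infty w_0(x')\,dx'$ be $C^2$ on $[0,\|X_0\|_\infty)$, where $\|X_0\|_\infty$ is the right end point of the support of $w_0$, and suppose that the beta function $\beta_0$ of $w_0$ satisfies $$\sup_{0\le x<\|X_0\|_\infty}\beta_0(x)\le\beta_\infty\qquad\text{and}\qquad \liminf_{x\to\|X_0\|_\infty}\beta_0(x)>0 .$$ Then there is a constant $C>0$, depending only on the function $\beta_0$ (with its domain $[0,\|X_0\|_\infty)$), such that every solution $w$ of the LSW system with initial data $w_0$ satisfies $$\Lambda(T)\ge C\,T\qquad\text{for all } T\ge 1 .$$ -/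

import Mathlib

open Set Filter Topology MeasureTheory

noncomputable section

namespace LSW

/-- `‖X‖_∞` for the positive random variable `X` with `P(X > x) = w x / w 0`: the right end
point of the support of the decreasing function `w` on `[0, ∞)`. It may be `⊤`. -/
def supportEnd (w : ℝ → ℝ) : EReal :=
  sSup ((fun x : ℝ => (x : EReal)) '' {x : ℝ | 0 ≤ x ∧ 0 < w x})

/-- The real interval `[0, a)`, where `a` may be infinite. -/
def interval (a : EReal) : Set ℝ := {x : ℝ | 0 ≤ x ∧ (x : EReal) < a}

/-- The filter on the real line of `x → a` with `x < a`, where `a` may be infinite. -/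
def leftOf (a : EReal) : Filter ℝ := comap (fun x : ℝ => (x : EReal)) (𝓝[<] a)

/-- `h(x) = ∫_x^∞ w(x') dx'`. -/
def tail (w : ℝ → ℝ) (x : ℝ) : ℝ := ∫ y in Ioi x, w y

/-- The beta function `β(x) = h''(x) h(x) / h'(x)²` of `w`, for `0 ≤ x < ‖X‖_∞`; the derivatives
are taken inside this interval, hence one-sided at `x = 0`. -/
def beta (w : ℝ → ℝ) (x : ℝ) : ℝ :=
  iteratedDerivWithin 2 (tail w) (interval (supportEnd w)) x * tail w x
    / (derivWithin (tail w) (interval (supportEnd w)) x) ^ 2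

/-- Initial data: integrable nonnegative decreasing functions on `[0, ∞)` of mass one whose beta
function is defined, that is, `h` is `C²` on `[0, ‖X‖_∞)`. -/
structure IsInitialDatum (w₀ : ℝ → ℝ) : Prop where
  nonneg : ∀ x, 0 ≤ x → 0 ≤ w₀ x
  antitoneOn : AntitoneOn w₀ (Ici 0)
  integrableOn : IntegrableOn w₀ (Ioi 0)
  mass : ∫ x in Ioi (0 : ℝ), w₀ x = 1
  contDiffOn_tail : ContDiffOn ℝ 2 (tail w₀) (interval (supportEnd w₀))

/-- The parameter `L(t)`, given by
`L(t)^{1/3} = (1/3) ∫_0^∞ x^{-2/3} w(x,t) dx / w(0,t)`. -/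
def scale (w : ℝ → ℝ → ℝ) (t : ℝ) : ℝ :=
  ((1 / 3 : ℝ) * (∫ x in Ioi (0 : ℝ), x ^ (-(2 / 3) : ℝ) * w x t) / w 0 t) ^ 3

/-- `w x t` (first variable volume, second variable time) is a global solution of the LSW system
with initial data `w₀`. The function `w` is nonnegative, continuous up to `x = 0` and `t = 0`,
decreasing in `x`, of mass one at all times, and the transport equation
`∂w/∂t = [1 - (x / L(t))^{1/3}] ∂w/∂x` holds classically at all points with `x > 0`, `t > 0` and
`w > 0`. Nothing is asked on the curve that bounds the support of `w`, where `w` is continuous but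
in general not differentiable; beyond it `w = 0` and the equation is trivial. -/
structure IsSolution (w₀ : ℝ → ℝ) (w : ℝ → ℝ → ℝ) : Prop where
  continuousOn : ContinuousOn (fun p : ℝ × ℝ => w p.1 p.2) (Ici 0 ×ˢ Ici 0)
  nonneg : ∀ x t, 0 ≤ x → 0 ≤ t → 0 ≤ w x t
  antitoneOn : ∀ t, 0 ≤ t → AntitoneOn (fun x => w x t) (Ici 0)
  integrableOn : ∀ t, 0 ≤ t → IntegrableOn (fun x => w x t) (Ioi 0)
  mass : ∀ t, 0 ≤ t → ∫ x in Ioi (0 : ℝ), w x t = 1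
  initial : ∀ x, 0 ≤ x → w x 0 = w₀ x
  differentiableAt : ∀ x t, 0 < x → 0 < t → 0 < w x t →
    DifferentiableAt ℝ (fun p : ℝ × ℝ => w p.1 p.2) (x, t)
  transport : ∀ x t, 0 < x → 0 < t → 0 < w x t →
    deriv (fun s => w x s) t
      = (1 - (x / scale w t) ^ (1 / 3 : ℝ)) * deriv (fun y => w y t) x

/-- The cluster density `c = -∂w/∂x`, so that `w(x,t) = ∫_x^∞ c(x',t) dx'`. -/
def density (w : ℝ → ℝ → ℝ) (x t : ℝ) : ℝ := -deriv (fun y => w y t) x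

/-- The mean cluster volume `Λ(t) = ∫_0^∞ x c(x,t) dx / ∫_0^∞ c(x,t) dx`. -/
def meanVolume (w : ℝ → ℝ → ℝ) (t : ℝ) : ℝ :=
  (∫ x in Ioi (0 : ℝ), x * density w x t) / ∫ x in Ioi (0 : ℝ), density w x t

end LSW

end

/-!
If `β ≤ 1/2`, then the graph of `w₀` lies above the chords from its points to the end `(a, 0)` of
its support. The flow of the transport equation is concave in the volume variable, so that this
property is preserved; together with conservation of mass it gives `x * w(0, t) ≤ 2` and
`x ^ (1/3) ≤ 4/3 * L(t) ^ (1/3)` on the support of `w(·, t)`. With these bounds the characteristics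
spread apart in a controlled way. First, after a time depending only on `a` and `ε`, the whole
support consists of points transported from `(a - ε, a)`, where `β₀` is bounded below by some
`δ > 0`. Secondly, this lower bound, which is a decay estimate for `w₀` near `a`, is transported
into `c ≥ k * w²` with `k = δ / (4 * exp 6)`. At `x = 0` the transport equation is `∂w/∂t = -c`;
hence `1 / w(0, t)`, which is the mean volume, grows at least at the rate `k`.
-/

namespace LSW

section Calculus

variable {f f' g : ℝ → ℝ} {a b : ℝ}

theorem antitoneOn_Icc_of_hasDerivAt_nonpos (hf : ContinuousOn f (Icc a b))
    (hd : ∀ x ∈ Ioo a b, HasDerivAt f (f' x) x) (hn : ∀ x ∈ Ioo a b, f' x ≤ 0) :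
    AntitoneOn f (Icc a b) :=
  antitoneOn_of_hasDerivWithinAt_nonpos (convex_Icc a b) hf
    (fun x hx => (hd x (interior_Icc.subset hx)).hasDerivWithinAt)
    fun x hx => hn x (interior_Icc.subset hx)

theorem monotoneOn_Icc_of_hasDerivAt_nonneg (hf : ContinuousOn f (Icc a b))
    (hd : ∀ x ∈ Ioo a b, HasDerivAt f (f' x) x) (hn : ∀ x ∈ Ioo a b, 0 ≤ f' x) :
    MonotoneOn f (Icc a b) :=
  monotoneOn_of_hasDerivWithinAt_nonneg (convex_Icc a b) hf
    (fun x hx => (hd x (interior_Icc.subset hx)).hasDerivWithinAt)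
    fun x hx => hn x (interior_Icc.subset hx)

theorem pos_of_hasDerivAt_mul (hf : ContinuousOn f (Icc a b)) (hg : ContinuousOn g (Icc a b))
    (hd : ∀ x ∈ Ioo a b, HasDerivAt f (g x * f x) x) (hb : 0 < f b) {x : ℝ} (hx : x ∈ Icc a b) :
    0 < f x := by
  have hab : a ≤ b := hx.1.trans hx.2
  set E : ℝ → ℝ := fun x => Real.exp (-∫ y in a..x, g y)
  have hcont : ContinuousOn (fun x => f x * E x) (Icc a b) := by
    refine hf.mul (ContinuousOn.rexp (ContinuousOn.neg ?_))
    have := intervalIntegral.continuousOn_primitive_interval (μ := volume) (f := g) (a := a)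
      (b := b) ((uIcc_of_le hab).symm ▸ hg.integrableOn_Icc)
    rwa [uIcc_of_le hab] at this
  have hderiv : ∀ x ∈ Ioo a b, HasDerivAt (fun x => f x * E x) 0 x := by
    intro x hx
    have hG : HasDerivAt (fun x => ∫ y in a..x, g y) (g x) x := by
      refine intervalIntegral.integral_hasDerivAt_right ?_ ?_
        (hg.continuousAt (Icc_mem_nhds hx.1 hx.2))
      · exact (hg.mono (Icc_subset_Icc_right hx.2.le)).intervalIntegrable_of_Icc hx.1.le
      · exact (hg.mono Ioo_subset_Icc_self).stronglyMeasurableAtFilter isOpen_Ioo x hx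
    refine ((hd x hx).mul hG.neg.exp).congr_deriv ?_
    ring
  have hanti := antitoneOn_Icc_of_hasDerivAt_nonpos hcont hderiv fun _ _ => le_rfl
  have hle : f b * E b ≤ f x * E x := hanti hx (right_mem_Icc.2 hab) hx.2
  exact pos_of_mul_pos_left ((mul_pos hb (Real.exp_pos _)).trans_le hle) (Real.exp_pos _).le

theorem eq_of_hasDerivAt_zero_of_pos (hf : ContinuousOn f (Icc a b))
    (hd : ∀ x ∈ Ioo a b, 0 < f x → HasDerivAt f 0 x) (hb : 0 < f b) {x : ℝ} (hx : x ∈ Icc a b) :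
    f x = f b := by
  have hconst : ∀ c ∈ Icc a b, (∀ x ∈ Ioo c b, 0 < f x) → f c = f b := by
    intro c hc hpos
    have hsub : Ioo c b ⊆ Ioo a b := Ioo_subset_Ioo_left hc.1
    have hf' := hf.mono (Icc_subset_Icc_left hc.1)
    have hd' : ∀ x ∈ Ioo c b, HasDerivAt f 0 x := fun x hx => hd x (hsub hx) (hpos x hx)
    have hl := left_mem_Icc.2 hc.2
    have hr := right_mem_Icc.2 hc.2
    exact le_antisymm
      (monotoneOn_Icc_of_hasDerivAt_nonneg hf' hd' (fun _ _ => le_rfl) hl hr hc.2)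
      (antitoneOn_Icc_of_hasDerivAt_nonpos hf' hd' (fun _ _ => le_rfl) hl hr hc.2)
  -- the last point at which `f` vanishes would contradict `hconst`
  have hpos : ∀ x ∈ Icc a b, 0 < f x := by
    by_contra! ⟨x, hx, hfx⟩
    have hcomp : IsCompact (Icc a b ∩ f ⁻¹' Iic 0) :=
      isCompact_Icc.of_isClosed_subset (hf.preimage_isClosed_of_isClosed isClosed_Icc isClosed_Iic)
        inter_subset_left
    obtain ⟨c, ⟨hc, hfc⟩, hmax⟩ := hcomp.exists_isGreatest ⟨x, hx, hfx⟩
    have hfc' : f c = f b := hconst c hc fun y hy => not_le.1 fun hfy =>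
      hy.1.not_ge (hmax ⟨⟨hc.1.trans hy.1.le, hy.2.le⟩, hfy⟩)
    exact hb.not_ge (hfc' ▸ hfc)
  exact hconst x hx fun y hy => hpos y ⟨hx.1.trans hy.1.le, hy.2.le⟩

end Calculus

/-- The functions that occur as `w(·, t)` for a solution `w` of the LSW system: continuous,
nonnegative and decreasing on `[0, ∞)`, with mass one. The values at negative reals are
irrelevant. -/
structure IsProfile (f : ℝ → ℝ) : Prop where
  continuousOn : ContinuousOn f (Ici 0)
  nonneg : ∀ x, 0 ≤ x → 0 ≤ f x
  antitoneOn : AntitoneOn f (Ici 0)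
  integrableOn : IntegrableOn f (Ioi 0)
  mass : ∫ x in Ioi (0 : ℝ), f x = 1

namespace IsProfile

variable {f : ℝ → ℝ} {a x : ℝ}

theorem zero_pos (hf : IsProfile f) : 0 < f 0 := by
  by_contra! h0
  have hzero : ∀ x ∈ Ioi (0 : ℝ), f x = 0 := fun x (hx : 0 < x) =>
    le_antisymm ((hf.antitoneOn self_mem_Ici hx.le hx.le).trans h0) (hf.nonneg x hx.le)
  have hmass := hf.mass
  rw [setIntegral_congr_fun measurableSet_Ioi hzero] at hmass
  simp at hmass

theorem pos_iff (hf : IsProfile f) (hx : 0 ≤ x) : 0 < f x ↔ (x : EReal) < supportEnd f := by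
  constructor
  · intro hfx
    have hright : ∀ᶠ y in 𝓝[>] x, 0 < f y :=
      ((hf.continuousOn x hx).mono fun y hy => hx.trans (le_of_lt hy)).eventually
        (lt_mem_nhds hfx)
    obtain ⟨y, hy, hxy : x < y⟩ := (hright.and self_mem_nhdsWithin).exists
    exact (EReal.coe_lt_coe hxy).trans_le (le_sSup ⟨y, ⟨hx.trans hxy.le, hy⟩, rfl⟩)
  · intro hlt
    obtain ⟨_, ⟨y, ⟨hy0, hy⟩, rfl⟩, hxy⟩ := lt_sSup_iff.1 hlt
    have hxy' : x < y := EReal.coe_lt_coe_iff.1 hxy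
    exact hy.trans_le (hf.antitoneOn hx hy0 hxy'.le)

theorem pos_iff_lt (hf : IsProfile f) (ha : supportEnd f = a) (hx : 0 ≤ x) :
    0 < f x ↔ x < a := by
  rw [hf.pos_iff hx, ha, EReal.coe_lt_coe_iff]

theorem supportEnd_pos (hf : IsProfile f) : 0 < supportEnd f := by
  simpa using (hf.pos_iff le_rfl).1 hf.zero_pos

theorem eq_zero_of_le (hf : IsProfile f) (ha : supportEnd f = a) (hx : 0 ≤ x) (hax : a ≤ x) :
    f x = 0 :=
  (hf.nonneg x hx).antisymm' (not_lt.1 fun h => hax.not_gt ((hf.pos_iff_lt ha hx).1 h))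

theorem deriv_nonpos (hf : IsProfile f) (hx : 0 < x) : deriv f x ≤ 0 := by
  rw [← derivWithin_of_mem_nhds (Ici_mem_nhds hx)]
  exact hf.antitoneOn.derivWithin_nonpos

theorem intervalIntegrable (hf : IsProfile f) (hx : 0 ≤ x) : IntervalIntegrable f volume 0 x :=
  (intervalIntegrable_iff_integrableOn_Ioc_of_le hx).2
    (hf.integrableOn.mono_set Ioc_subset_Ioi_self)

theorem tail_nonneg (hf : IsProfile f) (hx : 0 ≤ x) : 0 ≤ tail f x :=
  setIntegral_nonneg measurableSet_Ioi fun y (hy : x < y) => hf.nonneg y (hx.trans hy.le)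

theorem integral_add_tail (hf : IsProfile f) (hx : 0 ≤ x) :
    (∫ y in (0 : ℝ)..x, f y) + tail f x = 1 := by
  rw [← hf.mass, ← Ioc_union_Ioi_eq_Ioi hx, intervalIntegral.integral_of_le hx, tail]
  exact (setIntegral_union (Ioc_disjoint_Ioi le_rfl) measurableSet_Ioi
    (hf.integrableOn.mono_set Ioc_subset_Ioi_self)
    (hf.integrableOn.mono_set (Ioi_subset_Ioi hx))).symm

theorem integral_le_one (hf : IsProfile f) (hx : 0 ≤ x) : ∫ y in (0 : ℝ)..x, f y ≤ 1 := by
  linarith [hf.integral_add_tail hx, hf.tail_nonneg hx]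

theorem mul_le_one (hf : IsProfile f) (hx : 0 ≤ x) : x * f x ≤ 1 :=
  calc x * f x = ∫ _ in (0 : ℝ)..x, f x := by simp
    _ ≤ ∫ y in (0 : ℝ)..x, f y :=
      intervalIntegral.integral_mono_on hx intervalIntegrable_const (hf.intervalIntegrable hx)
        fun y hy => hf.antitoneOn hy.1 hx hy.2
    _ ≤ 1 := hf.integral_le_one hx

theorem tail_le_mul (hf : IsProfile f) (ha : supportEnd f = a) (hx : 0 ≤ x) (hxa : x ≤ a) :
    tail f x ≤ (a - x) * f x := by
  have htail : tail f x = ∫ y in Ioc x a, f y :=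
    setIntegral_eq_of_subset_of_forall_sdiff_eq_zero measurableSet_Ioi Ioc_subset_Ioi_self
      fun y hy => hf.eq_zero_of_le ha (hx.trans (le_of_lt hy.1))
        (le_of_not_ge fun hya => hy.2 ⟨hy.1, hya⟩)
  calc tail f x = ∫ y in Ioc x a, f y := htail
    _ ≤ ∫ _ in Ioc x a, f x :=
      setIntegral_mono_on (hf.integrableOn.mono_set fun y hy => hx.trans_lt hy.1)
        (integrableOn_const (by simp)) measurableSet_Ioc
        fun y hy => hf.antitoneOn hx (hx.trans hy.1.le) hy.1.le
    _ = (a - x) * f x := by simp [hxa]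

theorem one_le_mul_zero (hf : IsProfile f) (ha : supportEnd f = a) : 1 ≤ a * f 0 := by
  have ha0 : 0 < a := (hf.pos_iff_lt ha le_rfl).1 hf.zero_pos
  simpa [tail, hf.mass] using hf.tail_le_mul ha le_rfl ha0.le

theorem hasDerivAt_tail (hf : IsProfile f) (hx : 0 < x) : HasDerivAt (tail f) (-f x) x := by
  have hint : HasDerivAt (fun u => ∫ y in (0 : ℝ)..u, f y) (f x) x :=
    intervalIntegral.integral_hasDerivAt_right (hf.intervalIntegrable hx.le)
      ((hf.continuousOn.mono Ioi_subset_Ici_self).stronglyMeasurableAtFilter isOpen_Ioi x hx)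
      (hf.continuousOn.continuousAt (Ici_mem_nhds hx))
  refine (hint.const_sub 1).congr_of_eventuallyEq ?_
  filter_upwards [Ioi_mem_nhds hx] with y hy using
    eq_sub_of_add_eq' (hf.integral_add_tail (le_of_lt hy))

theorem continuousOn_tail (hf : IsProfile f) (hx : 0 ≤ x) : ContinuousOn (tail f) (Icc 0 x) := by
  have hint : ContinuousOn (fun u => ∫ y in (0 : ℝ)..u, f y) (Icc 0 x) := by
    rw [← uIcc_of_le hx]
    exact intervalIntegral.continuousOn_primitive_interval'
      (hf.intervalIntegrable hx) left_mem_uIcc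
  exact (continuousOn_const.sub hint).congr fun y hy =>
    eq_sub_of_add_eq' (hf.integral_add_tail hy.1)

end IsProfile

theorem interval_mem_nhds {a : EReal} {x : ℝ} (hx : 0 < x) (hxa : (x : EReal) < a) :
    interval a ∈ 𝓝 x := by
  filter_upwards [Ioi_mem_nhds hx,
    (isOpen_lt continuous_coe_real_ereal continuous_const).mem_nhds hxa] with y hy hya
  exact ⟨le_of_lt hy, hya⟩

section Beta

variable {f : ℝ → ℝ} {a x A δ : ℝ}

theorem IsProfile.differentiableAt_of_contDiffOn_tail (hf : IsProfile f)
    (hC : ContDiffOn ℝ 2 (tail f) (interval (supportEnd f))) (hx : 0 < x) (hfx : 0 < f x) :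
    DifferentiableAt ℝ f x := by
  have htail : deriv (tail f) =ᶠ[𝓝 x] fun y => -f y := by
    filter_upwards [Ioi_mem_nhds hx] with y hy using (hf.hasDerivAt_tail hy).deriv
  have hC' : ContDiffAt ℝ 2 (tail f) x :=
    hC.contDiffAt (interval_mem_nhds hx ((hf.pos_iff hx.le).1 hfx))
  have hd : DifferentiableAt ℝ (deriv (tail f)) x :=
    ((hC'.fderiv_right (m := 1) (by norm_num)).differentiableAt one_ne_zero).clm_apply
      (differentiableAt_const (1 : ℝ))
  simpa using (hd.congr_of_eventuallyEq htail.symm).neg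

theorem IsProfile.beta_eq (hf : IsProfile f) (hx : 0 < x) (hfx : 0 < f x) :
    beta f x = -deriv f x * tail f x / f x ^ 2 := by
  have hsupp := (hf.pos_iff hx.le).1 hfx
  have hmem := interval_mem_nhds hx hsupp
  have hfirst : ∀ y : ℝ, 0 < y → (y : EReal) < supportEnd f →
      derivWithin (tail f) (interval (supportEnd f)) y = -f y := fun y hy hya => by
    rw [derivWithin_of_mem_nhds (interval_mem_nhds hy hya), (hf.hasDerivAt_tail hy).deriv]
  have hsecond :
      iteratedDerivWithin 2 (tail f) (interval (supportEnd f)) x = -deriv f x := by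
    have hev : iteratedDerivWithin 1 (tail f) (interval (supportEnd f)) =ᶠ[𝓝 x]
        fun y => -f y := by
      filter_upwards [Ioi_mem_nhds hx,
        (isOpen_lt continuous_coe_real_ereal continuous_const).mem_nhds hsupp] with y hy hya
      rw [iteratedDerivWithin_one, hfirst y hy hya]
    rw [iteratedDerivWithin_succ, derivWithin_of_mem_nhds hmem, hev.deriv_eq, deriv.fun_neg]
  rw [beta, hfirst x hx hsupp, hsecond, neg_sq]

/-- The graph of `f` lies above the chords from its points to the points `(A, 0)` with `A` in the
support of `f`. The initial data with `β ≤ 1/2` have this property, and the LSW flow preserves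
it. -/
def IsStarConcave (f : ℝ → ℝ) : Prop :=
  ∀ ⦃y z A : ℝ⦄, 0 ≤ y → y ≤ z → z ≤ A → 0 < f A → f y * (A - z) ≤ f z * (A - y)

theorem IsProfile.half_mul_le_tail (hf : IsProfile f)
    (hC : ContDiffOn ℝ 2 (tail f) (interval (supportEnd f)))
    (hβ : ∀ x ∈ interval (supportEnd f), beta f x ≤ 1 / 2) (hx : 0 ≤ x) (hxA : x ≤ A)
    (hA : 0 < f A) : (A - x) / 2 * f x ≤ tail f x := by
  have hA0 : 0 ≤ A := hx.trans hxA
  have hpos : ∀ y ∈ Icc 0 A, 0 < f y := fun y hy =>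
    hA.trans_le (hf.antitoneOn hy.1 hA0 hy.2)
  have hanti : AntitoneOn (fun y => tail f y / f y + y / 2) (Icc 0 A) := by
    refine antitoneOn_Icc_of_hasDerivAt_nonpos (f' := fun y =>
      (-f y * f y - tail f y * deriv f y) / f y ^ 2 + 1 / 2) ?_ (fun y hy => ?_) fun y hy => ?_
    · exact ((hf.continuousOn_tail hA0).div (hf.continuousOn.mono Icc_subset_Ici_self)
        fun y hy => (hpos y hy).ne').add (by fun_prop)
    · have hfy := hpos y (Ioo_subset_Icc_self hy)
      exact ((hf.hasDerivAt_tail hy.1).div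
        (hf.differentiableAt_of_contDiffOn_tail hC hy.1 hfy).hasDerivAt hfy.ne').add
        ((hasDerivAt_id y).div_const 2)
    · have hfy := hpos y (Ioo_subset_Icc_self hy)
      have hb := hβ y ⟨hy.1.le, (hf.pos_iff hy.1.le).1 hfy⟩
      rw [hf.beta_eq hy.1 hfy, div_le_iff₀ (by positivity)] at hb
      rw [div_add_div _ _ (by positivity) two_ne_zero]
      exact div_nonpos_of_nonpos_of_nonneg (by linarith) (by positivity)
  have hle : tail f A / f A + A / 2 ≤ tail f x / f x + x / 2 :=
    hanti ⟨hx, hxA⟩ (right_mem_Icc.2 hA0) hxA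
  have htail : 0 ≤ tail f A / f A := div_nonneg (hf.tail_nonneg hA0) hA.le
  rw [← le_div_iff₀ (hpos x ⟨hx, hxA⟩)]
  linarith

theorem IsProfile.isStarConcave (hf : IsProfile f)
    (hC : ContDiffOn ℝ 2 (tail f) (interval (supportEnd f)))
    (hβ : ∀ x ∈ interval (supportEnd f), beta f x ≤ 1 / 2) : IsStarConcave f := by
  intro y z A hy hyz hzA hA
  rcases hzA.eq_or_lt with rfl | hzA
  · simpa using mul_nonneg hA.le (sub_nonneg.2 hyz)
  have hmono : MonotoneOn (fun x => f x / (A - x)) (Icc 0 z) := by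
    refine monotoneOn_Icc_of_hasDerivAt_nonneg (f' := fun x =>
      (deriv f x * (A - x) - f x * (-1)) / (A - x) ^ 2) ?_ (fun x hx => ?_) fun x hx => ?_
    · exact (hf.continuousOn.mono Icc_subset_Ici_self).div (by fun_prop)
        fun x hx => (sub_pos.2 (hx.2.trans_lt hzA)).ne'
    all_goals
      have hxA := hx.2.trans hzA
      have hfx : 0 < f x := hA.trans_le (hf.antitoneOn hx.1.le (hx.1.trans hxA).le hxA.le)
    · exact (hf.differentiableAt_of_contDiffOn_tail hC hx.1 hfx).hasDerivAt.div
        ((hasDerivAt_id x).const_sub A) (sub_pos.2 hxA).ne'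
    · have hb := hβ x ⟨hx.1.le, (hf.pos_iff hx.1.le).1 hfx⟩
      rw [hf.beta_eq hx.1 hfx, div_le_iff₀ (by positivity)] at hb
      have htail := mul_le_mul_of_nonneg_left (hf.half_mul_le_tail hC hβ hx.1.le hxA.le hA)
        (neg_nonneg.2 (hf.deriv_nonpos hx.1))
      have hslope : -deriv f x * (A - x) ≤ f x := le_of_mul_le_mul_right (by linarith) hfx
      exact div_nonneg (by linarith) (sq_nonneg _)
  have hle : f y / (A - y) ≤ f z / (A - z) :=
    hmono ⟨hy, hyz⟩ (right_mem_Icc.2 (hy.trans hyz)) hyz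
  rwa [div_le_div_iff₀ (by linarith) (by linarith)] at hle

/-- A lower bound `δ` for the relative rate `-(a - y) f'(y) / f(y)` of decay of `f` on
`(a - ε, a)`, in integrated form. -/
def HasEndDecay (f : ℝ → ℝ) (a ε δ : ℝ) : Prop :=
  ∀ ⦃y z : ℝ⦄, 0 < y → a - ε < y → y ≤ z → z < a → δ * f z * (z - y) ≤ (f y - f z) * (a - y)

theorem IsProfile.hasEndDecay (hf : IsProfile f)
    (hC : ContDiffOn ℝ 2 (tail f) (interval (supportEnd f))) (ha : supportEnd f = a) {ε : ℝ}
    (hδ : 0 ≤ δ) (hβ : ∀ x, 0 < x → a - ε < x → x < a → δ ≤ beta f x) :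
    HasEndDecay f a ε δ := by
  have hrate : ∀ x, 0 < x → a - ε < x → x < a → δ * f x ≤ -deriv f x * (a - x) := by
    intro x hx hεx hxa
    have hfx : 0 < f x := (hf.pos_iff_lt ha hx.le).2 hxa
    have hb := hβ x hx hεx hxa
    rw [hf.beta_eq hx hfx, le_div_iff₀ (by positivity)] at hb
    have htail := mul_le_mul_of_nonneg_left (hf.tail_le_mul ha hx.le hxa.le)
      (neg_nonneg.2 (hf.deriv_nonpos hx))
    exact le_of_mul_le_mul_right (by linarith) hfx
  intro y z hy hεy hyz hza
  rcases hyz.eq_or_lt with rfl | hyz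
  · simp
  have hdiff : ∀ x ∈ Ioo y z, HasDerivAt f (deriv f x) x := fun x hx =>
    (hf.differentiableAt_of_contDiffOn_tail hC (hy.trans hx.1)
      ((hf.pos_iff_lt ha (hy.trans hx.1).le).2 (hx.2.trans hza))).hasDerivAt
  obtain ⟨ξ, hξ, hslope⟩ := exists_hasDerivAt_eq_slope f (deriv f) hyz
    (hf.continuousOn.mono fun x hx => hy.le.trans hx.1) hdiff
  have hξ0 : 0 < ξ := hy.trans hξ.1
  rw [eq_div_iff (sub_pos.2 hyz).ne'] at hslope
  have hle : δ * f z ≤ -deriv f ξ * (a - y) :=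
    calc δ * f z ≤ δ * f ξ :=
          mul_le_mul_of_nonneg_left (hf.antitoneOn hξ0.le (hy.trans hyz).le hξ.2.le) hδ
      _ ≤ -deriv f ξ * (a - ξ) := hrate ξ hξ0 (hεy.trans hξ.1) (hξ.2.trans hza)
      _ ≤ -deriv f ξ * (a - y) := mul_le_mul_of_nonneg_left (by linarith [hξ.1])
          (neg_nonneg.2 (hf.deriv_nonpos hξ0))
  calc δ * f z * (z - y) ≤ -deriv f ξ * (a - y) * (z - y) :=
        mul_le_mul_of_nonneg_right hle (sub_pos.2 hyz).le
    _ = (f y - f z) * (a - y) := by linear_combination (y - a) * hslope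

end Beta

/-- The relative growth rates of the cube roots of cluster volumes, cut off so as to stay Lipschitz
near `0`: for `e ≤ x` this is the speed `(-1 + x / l t) / (3 x²)` of the characteristics. -/
noncomputable def cutoffSpeed (l : ℝ → ℝ) (e t x : ℝ) : ℝ :=
  (max x e)⁻¹ * (3 * l t)⁻¹ - (max x e)⁻¹ ^ 2 / 3

section Existence

variable {l : ℝ → ℝ} {e m T : ℝ}

theorem abs_inv_max_sub_inv_max_le (he : 0 < e) (x y : ℝ) :
    |(max x e)⁻¹ - (max y e)⁻¹| ≤ e⁻¹ ^ 2 * |x - y| := by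
  have hx : e ≤ max x e := le_max_right x e
  have hy : e ≤ max y e := le_max_right y e
  have hx0 := he.trans_le hx
  have hy0 := he.trans_le hy
  have hprod : e ^ 2 ≤ max x e * max y e := sq e ▸ mul_le_mul hx hy he.le hx0.le
  rw [inv_sub_inv hx0.ne' hy0.ne', abs_div, abs_of_pos (mul_pos hx0 hy0), inv_pow, inv_mul_eq_div,
    abs_sub_comm x y]
  exact div_le_div₀ (abs_nonneg _) (abs_max_sub_max_le_abs y x e) (pow_pos he 2) hprod

theorem inv_max_mem_Ioc (he : 0 < e) (x : ℝ) : (max x e)⁻¹ ∈ Ioc 0 e⁻¹ :=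
  ⟨inv_pos.2 (he.trans_le (le_max_right x e)), inv_anti₀ he (le_max_right x e)⟩

theorem inv_three_mul_mem_Ioc (hm : 0 < m) {u : ℝ} (hu : m ≤ u) :
    (3 * u)⁻¹ ∈ Ioc 0 (3 * m)⁻¹ :=
  ⟨by have := hm.trans_le hu; positivity, by gcongr⟩

theorem abs_cutoffSpeed_sub_le (he : 0 < e) (hm : 0 < m) {t : ℝ} (ht : m ≤ l t) (x y : ℝ) :
    |cutoffSpeed l e t x - cutoffSpeed l e t y| ≤
      ((3 * m)⁻¹ + 2 * e⁻¹ / 3) * e⁻¹ ^ 2 * |x - y| := by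
  have hfactor : cutoffSpeed l e t x - cutoffSpeed l e t y =
      ((3 * l t)⁻¹ - ((max x e)⁻¹ + (max y e)⁻¹) / 3) * ((max x e)⁻¹ - (max y e)⁻¹) := by
    simp only [cutoffSpeed]
    ring
  have hx := inv_max_mem_Ioc he x
  have hy := inv_max_mem_Ioc he y
  have hl := inv_three_mul_mem_Ioc hm ht
  have he' := inv_pos.2 he
  rw [hfactor, abs_mul, mul_assoc]
  refine mul_le_mul ?_ (abs_inv_max_sub_inv_max_le he x y) (abs_nonneg _)
    (add_nonneg (hl.1.trans_le hl.2).le (by positivity))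
  rw [abs_le]
  constructor <;> linarith [hx.1, hx.2, hy.1, hy.2, hl.1, hl.2]

theorem abs_cutoffSpeed_le (he : 0 < e) (hm : 0 < m) {t : ℝ} (ht : m ≤ l t) (x : ℝ) :
    |cutoffSpeed l e t x| ≤ e⁻¹ * (3 * m)⁻¹ + e⁻¹ ^ 2 / 3 := by
  obtain ⟨hx, hx'⟩ := inv_max_mem_Ioc he x
  obtain ⟨hl, hl'⟩ := inv_three_mul_mem_Ioc hm ht
  refine (abs_sub _ _).trans (add_le_add ?_ ?_)
  · rw [abs_of_pos (mul_pos hx hl)]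
    gcongr
  · rw [abs_of_nonneg (by positivity)]
    gcongr

theorem exists_hasDerivWithinAt_cutoffSpeed (hT : 0 ≤ T) (he : 0 < e)
    (hl : ContinuousOn l (Icc 0 T)) (hm : 0 < m) (hml : ∀ s ∈ Icc 0 T, m ≤ l s) (q : ℝ) :
    ∃ p : ℝ → ℝ, p T = q ∧
      ∀ s ∈ Icc 0 T, HasDerivWithinAt p (cutoffSpeed l e s (p s)) (Icc 0 T) s := by
  set B : ℝ := e⁻¹ * (3 * m)⁻¹ + e⁻¹ ^ 2 / 3
  set K : ℝ := ((3 * m)⁻¹ + 2 * e⁻¹ / 3) * e⁻¹ ^ 2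
  have hB : 0 ≤ B := by positivity
  have hK : 0 ≤ K := by positivity
  have hpl : IsPicardLindelof (cutoffSpeed l e) (⟨T, hT, le_rfl⟩ : Icc 0 T) q
      ⟨B * T, by positivity⟩ 0 ⟨B, hB⟩ ⟨K, hK⟩ := by
    refine ⟨fun t ht => ?_, fun x _ => ?_, fun t ht x _ => ?_, ?_⟩
    · exact LipschitzOnWith.of_dist_le_mul fun x _ y _ =>
        abs_cutoffSpeed_sub_le he hm (hml t ht) x y
    · exact (continuousOn_const.mul ((continuousOn_const.mul hl).inv₀ fun s hs =>
        (mul_pos three_pos (hm.trans_le (hml s hs))).ne')).sub continuousOn_const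
    · exact abs_cutoffSpeed_le he hm (hml t ht) x
    · change B * max (T - T) (T - 0) ≤ B * T - 0
      simp [hT]
  exact hpl.exists_eq_forall_mem_Icc_hasDerivWithinAt₀

theorem le_of_hasDerivWithinAt_neg_of_eq {p p' : ℝ → ℝ} {c : ℝ}
    (hp : ∀ s ∈ Icc 0 T, HasDerivWithinAt p (p' s) (Icc 0 T) s) (hT : c ≤ p T)
    (hneg : ∀ s ∈ Icc 0 T, p s = c → p' s < 0) : ∀ s ∈ Icc 0 T, c ≤ p s := by
  have hmaps : MapsTo (fun s => T - s) (Icc 0 T) (Icc 0 T) := fun s hs =>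
    ⟨sub_nonneg.2 hs.2, sub_le_self T hs.1⟩
  have hback : ∀ s ∈ Icc 0 T,
      HasDerivWithinAt (fun s => -p (T - s)) (p' (T - s)) (Icc 0 T) s := fun s hs =>
    (((hp _ (hmaps hs)).scomp s ((hasDerivAt_id s).const_sub T).hasDerivWithinAt
      hmaps).neg).congr_deriv (by simp)
  intro s hs
  have hle := image_le_of_deriv_right_lt_deriv_boundary (B := fun _ => -c) (B' := fun _ => 0)
    (fun s hs => (hback s hs).continuousWithinAt)
    (fun s hs => (hback s (Ico_subset_Icc_self hs)).mono_of_mem_nhdsWithin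
      (Icc_mem_nhdsGE_of_mem hs))
    (by simpa using hT) (fun s => hasDerivAt_const s (-c))
    (fun s hs heq => hneg _ (hmaps (Ico_subset_Icc_self hs)) (neg_injective heq)) (hmaps hs)
  simpa using hle

end Existence

/-- A characteristic curve `x = p³` of the transport equation on the time interval `[0, T]`, where
`l = L^{1/3}`. -/
structure IsCharacteristic (l : ℝ → ℝ) (T : ℝ) (p : ℝ → ℝ) : Prop where
  continuousOn : ContinuousOn p (Icc 0 T)
  pos : ∀ s ∈ Icc 0 T, 0 < p s
  hasDerivAt : ∀ s ∈ Ioo 0 T, HasDerivAt p ((-1 + p s / l s) / (3 * p s ^ 2)) s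

/-- The relative rate at which the distance between the characteristics `p³` and `r³` grows. -/
noncomputable def separationRate (l p r : ℝ → ℝ) (s : ℝ) : ℝ :=
  (l s * (r s ^ 2 + r s * p s + p s ^ 2))⁻¹

namespace IsCharacteristic

variable {l p r P : ℝ → ℝ} {T s : ℝ}

theorem exists_of_continuousOn (hT : 0 ≤ T) (hl : ContinuousOn l (Icc 0 T))
    (hpos : ∀ s ∈ Icc 0 T, 0 < l s) {q : ℝ} (hq : 0 < q) :
    ∃ p, IsCharacteristic l T p ∧ p T = q := by
  obtain ⟨t, ht, hmin⟩ := isCompact_Icc.exists_isMinOn (nonempty_Icc.2 hT) hl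
  have hml : ∀ s ∈ Icc 0 T, l t ≤ l s := fun s hs => hmin hs
  have hlt := hpos t ht
  -- at `p = e` the speed is negative, so that `p` cannot fall below `e` backwards in time
  obtain ⟨e, he, hemin⟩ := exists_between (lt_min hq hlt)
  obtain ⟨p, hpT, hp⟩ := exists_hasDerivWithinAt_cutoffSpeed hT he hl hlt hml q
  have hep : ∀ s ∈ Icc 0 T, e ≤ p s := by
    refine le_of_hasDerivWithinAt_neg_of_eq hp (hpT ▸ (lt_min_iff.1 hemin).1.le) fun s hs hse => ?_
    have hls : e < l s := (lt_min_iff.1 hemin).2.trans_le (hml s hs)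
    have hl0 := hpos s hs
    have hspeed : cutoffSpeed l e s (p s) = (e - l s) / (3 * e ^ 2 * l s) := by
      rw [cutoffSpeed, hse, max_self]
      field_simp
    rw [hspeed]
    exact div_neg_of_neg_of_pos (sub_neg.2 hls) (by positivity)
  refine ⟨p, ⟨fun s hs => (hp s hs).continuousWithinAt, fun s hs => he.trans_le (hep s hs),
    fun s hs => ?_⟩, hpT⟩
  have hs' := Ioo_subset_Icc_self hs
  have hps := he.trans_le (hep s hs')
  have hls := hpos s hs'
  refine ((hp s hs').hasDerivAt (Icc_mem_nhds hs.1 hs.2)).congr_deriv ?_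
  rw [cutoffSpeed, max_eq_left (hep s hs')]
  field_simp
  ring

theorem continuousOn_cube (hp : IsCharacteristic l T p) :
    ContinuousOn (fun s => p s ^ 3) (Icc 0 T) :=
  hp.continuousOn.pow 3

theorem cube_pos (hp : IsCharacteristic l T p) (hs : s ∈ Icc 0 T) : 0 < p s ^ 3 :=
  pow_pos (hp.pos s hs) 3

theorem cube_lt_cube_iff (hp : IsCharacteristic l T p) (hr : IsCharacteristic l T r)
    (hs : s ∈ Icc 0 T) : p s ^ 3 < r s ^ 3 ↔ p s < r s :=
  pow_lt_pow_iff_left₀ (hp.pos s hs).le (hr.pos s hs).le three_ne_zero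

theorem hasDerivAt_cube (hp : IsCharacteristic l T p) (hs : s ∈ Ioo 0 T) :
    HasDerivAt (fun s => p s ^ 3) (-1 + p s / l s) s := by
  have hps := hp.pos s (Ioo_subset_Icc_self hs)
  refine ((hp.hasDerivAt s hs).pow 3).congr_deriv ?_
  rw [Nat.cast_ofNat]
  field_simp

theorem hasDerivAt_cube_sub_cube (hp : IsCharacteristic l T p) (hr : IsCharacteristic l T r)
    (hs : s ∈ Ioo 0 T) :
    HasDerivAt (fun s => r s ^ 3 - p s ^ 3)
      (separationRate l p r s * (r s ^ 3 - p s ^ 3)) s := by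
  have hps := hp.pos s (Ioo_subset_Icc_self hs)
  have hrs := hr.pos s (Ioo_subset_Icc_self hs)
  refine ((hr.hasDerivAt_cube hs).sub (hp.hasDerivAt_cube hs)).congr_deriv ?_
  rw [separationRate, mul_inv, show r s ^ 3 - p s ^ 3 =
    (r s ^ 2 + r s * p s + p s ^ 2) * (r s - p s) by ring]
  field_simp
  ring

theorem lt_of_lt (hp : IsCharacteristic l T p) (hr : IsCharacteristic l T r)
    (hl : ContinuousOn l (Icc 0 T)) (hpos : ∀ s ∈ Icc 0 T, 0 < l s) (h : p T < r T)
    (hs : s ∈ Icc 0 T) : p s < r s := by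
  have hrate : ContinuousOn (separationRate l p r) (Icc 0 T) := by
    refine ContinuousOn.inv₀ (hl.mul (((hr.continuousOn.pow 2).add
      (hr.continuousOn.mul hp.continuousOn)).add (hp.continuousOn.pow 2))) fun s hs => ?_
    have := hp.pos s hs
    have := hr.pos s hs
    have := hpos s hs
    positivity
  have hT : T ∈ Icc 0 T := ⟨hs.1.trans hs.2, le_rfl⟩
  rw [← hp.cube_lt_cube_iff hr hs, ← sub_pos]
  exact pos_of_hasDerivAt_mul (hr.continuousOn_cube.sub hp.continuousOn_cube) hrate
    (fun _ => hp.hasDerivAt_cube_sub_cube hr)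
    (sub_pos.2 ((hp.cube_lt_cube_iff hr hT).2 h)) hs

end IsCharacteristic

section Comparison

theorem antitoneOn_div_mul_exp {N M φ α β φ' : ℝ → ℝ} {a b : ℝ} (hNc : ContinuousOn N (Icc a b))
    (hMc : ContinuousOn M (Icc a b)) (hφc : ContinuousOn φ (Icc a b))
    (hN : ∀ s ∈ Ioo a b, HasDerivAt N (α s * N s) s)
    (hM : ∀ s ∈ Ioo a b, HasDerivAt M (β s * M s) s)
    (hφ : ∀ s ∈ Ioo a b, HasDerivAt φ (φ' s) s)
    (hN0 : ∀ s ∈ Icc a b, 0 ≤ N s) (hM0 : ∀ s ∈ Icc a b, 0 < M s)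
    (h : ∀ s ∈ Ioo a b, α s - β s + φ' s ≤ 0) :
    AntitoneOn (fun s => N s / M s * Real.exp (φ s)) (Icc a b) := by
  refine antitoneOn_Icc_of_hasDerivAt_nonpos
    (f' := fun s => (α s - β s + φ' s) * (N s / M s * Real.exp (φ s)))
    ((hNc.div hMc fun s hs => (hM0 s hs).ne').mul hφc.rexp) (fun s hs => ?_) fun s hs => ?_
  all_goals have hs' := Ioo_subset_Icc_self hs
  · have hMs := (hM0 s hs').ne'
    refine (((hN s hs).div (hM s hs) hMs).mul (hφ s hs).exp).congr_deriv ?_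
    simp only [Pi.div_apply]
    field_simp
  · exact mul_nonpos_of_nonpos_of_nonneg (h s hs)
      (mul_nonneg (div_nonneg (hN0 s hs') (hM0 s hs').le) (Real.exp_pos _).le)

/-- The bound behind `IsCharacteristic.sub_mul_sub_le`, for `x = p`, `y = P` and `l` at a given
time; the last term is the derivative of `6 p / P`. -/
theorem rate_sub_rate_add_deriv_le {x y l : ℝ} (hx : 0 < x) (hxy : x < y) (hl : 0 < l)
    (hyl : y ≤ 4 / 3 * l) :
    (l * (3 * x ^ 2))⁻¹ - (l * (y ^ 2 + y * x + x ^ 2))⁻¹ +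
      6 * (((-1 + x / l) / (3 * x ^ 2) * y - x * ((-1 + y / l) / (3 * y ^ 2))) / y ^ 2) ≤ 0 := by
  have hy : 0 < y := hx.trans hxy
  have hyx : 0 < y - x := sub_pos.2 hxy
  set X := y ^ 2 + y * x + x ^ 2 with hX
  have hX0 : 0 < X := by positivity
  have hrates : (l * (3 * x ^ 2))⁻¹ - (l * X)⁻¹ ≤ 2 * (y - x) / (3 * x ^ 2 * y ^ 2) := by
    have heq : (l * (3 * x ^ 2))⁻¹ - (l * X)⁻¹ =
        (y - x) * (y + 2 * x) / (3 * x ^ 2 * (l * X)) := by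
      field_simp
      rw [hX]
      ring
    have hle : (y + 2 * x) * y ^ 2 ≤ 2 * (l * X) := by
      have hXl : y * X ≤ 4 / 3 * l * X := mul_le_mul_of_nonneg_right hyl hX0.le
      nlinarith [mul_nonneg hy.le (sq_nonneg (y - x)), mul_nonneg hy.le (sq_nonneg x)]
    rw [heq, div_le_div_iff₀ (by positivity) (by positivity)]
    linarith [mul_le_mul_of_nonneg_left hle (mul_nonneg hyx.le (by positivity : 0 ≤ 3 * x ^ 2))]
  have hratio : ((-1 + x / l) / (3 * x ^ 2) * y - x * ((-1 + y / l) / (3 * y ^ 2))) / y ^ 2 ≤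
      -((y - x) / (9 * x ^ 2 * y ^ 2)) := by
    have heq : ((-1 + x / l) / (3 * x ^ 2) * y - x * ((-1 + y / l) / (3 * y ^ 2))) / y ^ 2 =
        -((y - x) * (X - y / l * (x * y + x ^ 2)) / (3 * x ^ 2 * y ^ 4)) := by
      field_simp
      rw [hX]
      ring
    have hle : y ^ 2 ≤ 3 * (X - y / l * (x * y + x ^ 2)) := by
      have hyl' : y / l * (x * y + x ^ 2) ≤ 4 / 3 * (x * y + x ^ 2) :=
        mul_le_mul_of_nonneg_right ((div_le_iff₀ hl).2 hyl) (by positivity)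
      nlinarith
    rw [heq, neg_le_neg_iff, div_le_div_iff₀ (by positivity) (by positivity)]
    linarith [mul_le_mul_of_nonneg_left hle
      (mul_nonneg hyx.le (by positivity : 0 ≤ 3 * x ^ 2 * y ^ 2))]
  have hsplit : 2 * (y - x) / (3 * x ^ 2 * y ^ 2) = 6 * ((y - x) / (9 * x ^ 2 * y ^ 2)) := by
    field_simp
    norm_num
  linarith

/-- The bound behind `IsCharacteristic.sub_le_mul_exp`, for `x = p`, `y = P` and `l` at a given
time. -/
theorem rate_sub_rate_add_le {x y l κ : ℝ} (hx : 0 < x) (hxy : x < y) (hl : 0 < l)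
    (hyl : y ≤ 4 / 3 * l) (hκ : y ^ 3 * κ ≤ 2) :
    (-1 + y / l) / y ^ 3 - (l * (y ^ 2 + y * x + x ^ 2))⁻¹ + κ / 18 ≤ 0 := by
  have hy : 0 < y := hx.trans hxy
  have hrate : (3 * l * y ^ 2)⁻¹ ≤ (l * (y ^ 2 + y * x + x ^ 2))⁻¹ := by
    refine inv_anti₀ (by positivity) ?_
    rw [mul_comm 3 l, mul_assoc]
    exact mul_le_mul_of_nonneg_left (by nlinarith) hl.le
  have hκ' : κ / 18 ≤ 1 / (9 * y ^ 3) := by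
    rw [div_le_div_iff₀ (by norm_num) (by positivity)]
    linarith
  have hyl' : y / l ≤ 4 / 3 := (div_le_iff₀ hl).2 hyl
  have hsum : (-1 + y / l) / y ^ 3 - (3 * l * y ^ 2)⁻¹ + 1 / (9 * y ^ 3) =
      (2 / 3 * (y / l) - 8 / 9) / y ^ 3 := by
    field_simp
    ring
  have hneg : (2 / 3 * (y / l) - 8 / 9) / y ^ 3 ≤ 0 :=
    div_nonpos_of_nonpos_of_nonneg (by linarith) (by positivity)
  linarith

end Comparison

namespace IsCharacteristic

variable {l p r P : ℝ → ℝ} {T s : ℝ}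

/-- The flow map of the transport equation is concave. -/
theorem sub_mul_sub_le_of_lt (hT : 0 ≤ T) (hp : IsCharacteristic l T p)
    (hr : IsCharacteristic l T r) (hP : IsCharacteristic l T P) (hpos : ∀ s ∈ Icc 0 T, 0 < l s)
    (hpr : ∀ s ∈ Icc 0 T, p s < r s) (hrP : ∀ s ∈ Icc 0 T, r s < P s) :
    (P T ^ 3 - r T ^ 3) * (P 0 ^ 3 - p 0 ^ 3) ≤ (P 0 ^ 3 - r 0 ^ 3) * (P T ^ 3 - p T ^ 3) := by
  have hN : ∀ s ∈ Icc 0 T, 0 < P s ^ 3 - r s ^ 3 := fun s hs =>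
    sub_pos.2 ((hr.cube_lt_cube_iff hP hs).2 (hrP s hs))
  have hM : ∀ s ∈ Icc 0 T, 0 < P s ^ 3 - p s ^ 3 := fun s hs =>
    sub_pos.2 ((hp.cube_lt_cube_iff hP hs).2 ((hpr s hs).trans (hrP s hs)))
  have hanti := antitoneOn_div_mul_exp (N := fun s => P s ^ 3 - r s ^ 3)
    (M := fun s => P s ^ 3 - p s ^ 3) (hP.continuousOn_cube.sub hr.continuousOn_cube)
    (hP.continuousOn_cube.sub hp.continuousOn_cube) continuousOn_const
    (fun _ => hr.hasDerivAt_cube_sub_cube hP) (fun _ => hp.hasDerivAt_cube_sub_cube hP)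
    (fun s _ => hasDerivAt_const s (0 : ℝ)) (fun s hs => (hN s hs).le) hM fun s hs => by
      have hs' := Ioo_subset_Icc_self hs
      have := hp.pos s hs'
      have := hP.pos s hs'
      have := hpos s hs'
      have hle := (hpr s hs').le
      simp only [add_zero, sub_nonpos, separationRate]
      gcongr
  have h0 := left_mem_Icc.2 hT
  have hle := hanti h0 (right_mem_Icc.2 hT) hT
  simp only [Real.exp_zero, mul_one] at hle
  rwa [div_le_div_iff₀ (hM T (right_mem_Icc.2 hT)) (hM 0 h0)] at hle

/-- As long as `x ≤ (4/3)³ L` along the top characteristic `P³`, the slope of the flow map at a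
lower characteristic is controlled by its mean slope between the two characteristics. -/
theorem sub_mul_sub_le (hT : 0 ≤ T) (hp : IsCharacteristic l T p) (hr : IsCharacteristic l T r)
    (hP : IsCharacteristic l T P) (hpos : ∀ s ∈ Icc 0 T, 0 < l s)
    (hpr : ∀ s ∈ Icc 0 T, p s < r s) (hpP : ∀ s ∈ Icc 0 T, p s < P s)
    (hscale : ∀ s ∈ Icc 0 T, P s ≤ 4 / 3 * l s) :
    (r T ^ 3 - p T ^ 3) * (P 0 ^ 3 - p 0 ^ 3) ≤
      Real.exp 6 * ((r 0 ^ 3 - p 0 ^ 3) * (P T ^ 3 - p T ^ 3)) := by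
  have hN : ∀ s ∈ Icc 0 T, 0 < r s ^ 3 - p s ^ 3 := fun s hs =>
    sub_pos.2 ((hp.cube_lt_cube_iff hr hs).2 (hpr s hs))
  have hM : ∀ s ∈ Icc 0 T, 0 < P s ^ 3 - p s ^ 3 := fun s hs =>
    sub_pos.2 ((hp.cube_lt_cube_iff hP hs).2 (hpP s hs))
  have hanti := antitoneOn_div_mul_exp (N := fun s => r s ^ 3 - p s ^ 3)
    (M := fun s => P s ^ 3 - p s ^ 3) (φ := fun s => 6 * (p s / P s))
    (hr.continuousOn_cube.sub hp.continuousOn_cube)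
    (hP.continuousOn_cube.sub hp.continuousOn_cube)
    (continuousOn_const.mul (hp.continuousOn.div hP.continuousOn fun s hs => (hP.pos s hs).ne'))
    (fun _ => hp.hasDerivAt_cube_sub_cube hr) (fun _ => hp.hasDerivAt_cube_sub_cube hP)
    (fun s hs => ((hp.hasDerivAt s hs).div (hP.hasDerivAt s hs)
      (hP.pos s (Ioo_subset_Icc_self hs)).ne').const_mul 6)
    (fun s hs => (hN s hs).le) hM fun s hs => by
      have hs' := Ioo_subset_Icc_self hs
      have hps := hp.pos s hs'
      have hls := hpos s hs'
      have hrate : separationRate l p r s ≤ (l s * (3 * p s ^ 2))⁻¹ := by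
        rw [separationRate]
        gcongr
        nlinarith [hpr s hs']
      refine le_trans ?_ (rate_sub_rate_add_deriv_le hps (hpP s hs') hls (hscale s hs'))
      gcongr
      exact le_rfl
  have h0 := left_mem_Icc.2 hT
  have hT' := right_mem_Icc.2 hT
  have hq : p 0 / P 0 ≤ 1 := ((div_lt_one (hP.pos 0 h0)).2 (hpP 0 h0)).le
  have hqT : 0 < p T / P T := div_pos (hp.pos T hT') (hP.pos T hT')
  rw [← mul_assoc, ← div_le_div_iff₀ (hM T hT') (hM 0 h0), mul_div_assoc, mul_comm (Real.exp 6)]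
  calc (r T ^ 3 - p T ^ 3) / (P T ^ 3 - p T ^ 3)
      ≤ (r T ^ 3 - p T ^ 3) / (P T ^ 3 - p T ^ 3) * Real.exp (6 * (p T / P T)) :=
        le_mul_of_one_le_right (div_pos (hN T hT') (hM T hT')).le
          (Real.one_le_exp (by positivity))
    _ ≤ (r 0 ^ 3 - p 0 ^ 3) / (P 0 ^ 3 - p 0 ^ 3) * Real.exp (6 * (p 0 / P 0)) := hanti h0 hT' hT
    _ ≤ (r 0 ^ 3 - p 0 ^ 3) / (P 0 ^ 3 - p 0 ^ 3) * Real.exp 6 :=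
        mul_le_mul_of_nonneg_left (Real.exp_le_exp.2 (by linarith))
          (div_pos (hN 0 h0) (hM 0 h0)).le

/-- Lower characteristics separate exponentially from the top one, as long as the latter is
bounded. -/
theorem sub_le_mul_exp (hT : 0 ≤ T) (hp : IsCharacteristic l T p)
    (hP : IsCharacteristic l T P) (hpos : ∀ s ∈ Icc 0 T, 0 < l s)
    (hpP : ∀ s ∈ Icc 0 T, p s < P s) (hscale : ∀ s ∈ Icc 0 T, P s ≤ 4 / 3 * l s) {κ : ℝ}
    (hbound : ∀ s ∈ Icc 0 T, P s ^ 3 * κ ≤ 2) :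
    P 0 ^ 3 - p 0 ^ 3 ≤ P 0 ^ 3 * Real.exp (-(κ / 18 * T)) := by
  have hM : ∀ s ∈ Icc 0 T, 0 < P s ^ 3 - p s ^ 3 := fun s hs =>
    sub_pos.2 ((hp.cube_lt_cube_iff hP hs).2 (hpP s hs))
  have hanti := antitoneOn_div_mul_exp (N := fun s => P s ^ 3) (M := fun s => P s ^ 3 - p s ^ 3)
    (α := fun s => (-1 + P s / l s) / P s ^ 3) (φ := fun s => κ / 18 * s) hP.continuousOn_cube
    (hP.continuousOn_cube.sub hp.continuousOn_cube) (by fun_prop)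
    (fun s hs => (hP.hasDerivAt_cube hs).congr_deriv
      (div_mul_cancel₀ _ (hP.cube_pos (Ioo_subset_Icc_self hs)).ne').symm)
    (fun _ => hp.hasDerivAt_cube_sub_cube hP)
    (fun s _ => (hasDerivAt_id s).const_mul (κ / 18)) (fun s hs => (hP.cube_pos hs).le) hM
    fun s hs => by
      have hs' := Ioo_subset_Icc_self hs
      rw [mul_one, separationRate]
      exact rate_sub_rate_add_le (hp.pos s hs') (hpP s hs') (hpos s hs') (hscale s hs')
        (hbound s hs')
  have h0 := left_mem_Icc.2 hT
  have hT' := right_mem_Icc.2 hT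
  have hratio : 1 ≤ P T ^ 3 / (P T ^ 3 - p T ^ 3) :=
    (one_le_div (hM T hT')).2 (sub_le_self _ (hp.cube_pos hT').le)
  have hle : Real.exp (κ / 18 * T) ≤ P 0 ^ 3 / (P 0 ^ 3 - p 0 ^ 3) := by
    calc Real.exp (κ / 18 * T)
        ≤ P T ^ 3 / (P T ^ 3 - p T ^ 3) * Real.exp (κ / 18 * T) :=
          le_mul_of_one_le_left (Real.exp_pos _).le hratio
      _ ≤ P 0 ^ 3 / (P 0 ^ 3 - p 0 ^ 3) := by simpa using hanti h0 hT' hT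
  rw [Real.exp_neg, ← div_eq_mul_inv, le_div_iff₀' (Real.exp_pos _)]
  exact (le_div_iff₀ (hM 0 h0)).1 hle

end IsCharacteristic

section StarConcave

variable {f : ℝ → ℝ} {a A y z : ℝ}

theorem IsProfile.mul_zero_le_two (hf : IsProfile f) (hs : IsStarConcave f) (hA : 0 ≤ A)
    (hfA : 0 < f A) : A * f 0 ≤ 2 := by
  rcases hA.eq_or_lt with rfl | hA
  · simp
  have hle : ∫ x in (0 : ℝ)..A, f 0 * (A - x) ≤ ∫ x in (0 : ℝ)..A, f x * A :=
    intervalIntegral.integral_mono_on hA.le (Continuous.intervalIntegrable (by fun_prop) _ _)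
      ((hf.intervalIntegrable hA.le).mul_const A)
      fun x hx => by simpa using hs le_rfl hx.1 hx.2 hfA
  have htriangle : ∫ x in (0 : ℝ)..A, f 0 * (A - x) = f 0 * (A ^ 2 / 2) := by
    rw [intervalIntegral.integral_const_mul, intervalIntegral.integral_sub (by simp) (by simp)]
    simp only [intervalIntegral.integral_const, integral_id, smul_eq_mul]
    ring
  rw [htriangle, intervalIntegral.integral_mul_const] at hle
  have hmass := mul_le_mul_of_nonneg_right (hf.integral_le_one hA.le) hA.le
  exact le_of_mul_le_mul_right (by linarith) hA

theorem IsProfile.supportEnd_le (hf : IsProfile f) (hs : IsStarConcave f) :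
    supportEnd f ≤ (2 / f 0 : ℝ) := by
  refine sSup_le ?_
  rintro _ ⟨A, ⟨hA, hfA⟩, rfl⟩
  exact EReal.coe_le_coe ((le_div_iff₀ hf.zero_pos).2 (hf.mul_zero_le_two hs hA hfA))

theorem IsProfile.exists_supportEnd_eq (hf : IsProfile f) (hs : IsStarConcave f) :
    ∃ a : ℝ, 0 < a ∧ supportEnd f = a := by
  have hpos := hf.supportEnd_pos
  have hlt := (hf.supportEnd_le hs).trans_lt (EReal.coe_lt_top _)
  exact ⟨(supportEnd f).toReal, EReal.toReal_pos hpos hlt.ne,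
    (EReal.coe_toReal hlt.ne (EReal.bot_lt_zero.trans hpos).ne').symm⟩

theorem IsProfile.supportEnd_mul_zero_le_two (hf : IsProfile f) (hs : IsStarConcave f)
    (ha : supportEnd f = a) : a * f 0 ≤ 2 :=
  (le_div_iff₀ hf.zero_pos).1 (EReal.coe_le_coe_iff.1 (ha ▸ hf.supportEnd_le hs))

theorem IsProfile.mul_sub_le (hf : IsProfile f) (hs : IsStarConcave f) (ha : supportEnd f = a)
    (hy : 0 ≤ y) (hyz : y ≤ z) (hza : z < a) : f y * (a - z) ≤ f z * (a - y) := by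
  have hlim : ∀ c u : ℝ, Tendsto (fun A => c * (A - u)) (𝓝[<] a) (𝓝 (c * (a - u))) := fun c u =>
    (Continuous.tendsto (by fun_prop) a).mono_left nhdsWithin_le_nhds
  refine le_of_tendsto_of_tendsto (hlim (f y) z) (hlim (f z) y) ?_
  filter_upwards [Ioo_mem_nhdsLT hza] with A hA
  exact hs hy hyz hA.1.le ((hf.pos_iff_lt ha ((hy.trans hyz).trans hA.1.le)).2 hA.2)

theorem IsProfile.sub_le_sq_mul (hf : IsProfile f) (hs : IsStarConcave f) (ha : supportEnd f = a)
    (hz : 0 ≤ z) (hza : z < a) : a - z ≤ a ^ 2 * f z := by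
  have hchord := hf.mul_sub_le hs ha le_rfl hz hza
  rw [sub_zero] at hchord
  calc a - z ≤ a * f 0 * (a - z) :=
        le_mul_of_one_le_left (sub_pos.2 hza).le (hf.one_le_mul_zero ha)
    _ = a * (f 0 * (a - z)) := mul_assoc _ _ _
    _ ≤ a * (f z * a) := mul_le_mul_of_nonneg_left hchord (hz.trans hza.le)
    _ = a ^ 2 * f z := by ring

theorem IsProfile.exists_pos_lt (hf : IsProfile f) {η : ℝ} (hη : 0 < η) :
    ∃ x, 0 < x ∧ 0 < f x ∧ f x < η := by
  obtain ⟨v, hv, hvmin⟩ := exists_between (lt_min hη hf.zero_pos)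
  obtain ⟨hvη, hvz⟩ := lt_min_iff.1 hvmin
  have hX : 0 ≤ v⁻¹ := (inv_pos.2 hv).le
  have hfX : f v⁻¹ ≤ v := by
    have hle := hf.mul_le_one hX
    rwa [inv_mul_le_iff₀ hv, mul_one] at hle
  obtain ⟨x, hx, rfl⟩ := intermediate_value_Icc' hX (hf.continuousOn.mono Icc_subset_Ici_self)
    ⟨hfX, hvz.le⟩
  exact ⟨x, hx.1.lt_of_ne (by rintro rfl; exact hvz.false), hv, hvη⟩

end StarConcave

section Moments

variable {f g : ℝ → ℝ} {a P M x : ℝ}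

/-- An integrable majorant of `x ^ (-2/3) * f x` for all profiles `f` with `f 0 ≤ M`. -/
noncomputable def majorant (M x : ℝ) : ℝ :=
  if x ≤ 1 then x ^ (-(2 / 3) : ℝ) * M else x ^ (-(5 / 3) : ℝ)

theorem integrableOn_majorant (M : ℝ) : IntegrableOn (majorant M) (Ioi 0) := by
  rw [← Ioc_union_Ioi_eq_Ioi zero_le_one]
  refine IntegrableOn.union ?_ ?_
  · have hint : IntegrableOn (fun x : ℝ => x ^ (-(2 / 3) : ℝ)) (Ioc 0 1) :=
      (intervalIntegrable_iff_integrableOn_Ioc_of_le zero_le_one).1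
        (intervalIntegral.intervalIntegrable_rpow' (by norm_num))
    exact IntegrableOn.congr_fun (Integrable.mul_const hint M)
      (fun x hx => (if_pos hx.2).symm) measurableSet_Ioc
  · exact (integrableOn_Ioi_rpow_of_lt (by norm_num) one_pos).congr_fun
      (fun x hx => (if_neg (not_le.2 hx)).symm) measurableSet_Ioi

theorem IsProfile.norm_rpow_mul_le_majorant (hf : IsProfile f) (hM : f 0 ≤ M) (hx : 0 < x) :
    ‖x ^ (-(2 / 3) : ℝ) * f x‖ ≤ majorant M x := by
  have hr : 0 ≤ x ^ (-(2 / 3) : ℝ) := Real.rpow_nonneg hx.le _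
  rw [Real.norm_of_nonneg (mul_nonneg hr (hf.nonneg x hx.le)), majorant]
  split_ifs
  · exact mul_le_mul_of_nonneg_left ((hf.antitoneOn self_mem_Ici hx.le hx.le).trans hM) hr
  · have hdecay : f x ≤ x⁻¹ := by
      rw [← one_div, le_div_iff₀' hx]
      exact hf.mul_le_one hx.le
    have hsplit : x ^ (-(5 / 3) : ℝ) = x ^ (-(2 / 3) : ℝ) * x⁻¹ := by
      rw [← Real.rpow_neg_one x, ← Real.rpow_add hx]
      norm_num
    exact (mul_le_mul_of_nonneg_left hdecay hr).trans_eq hsplit.symm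

theorem IsProfile.aestronglyMeasurable_rpow_mul (hf : IsProfile f) :
    AEStronglyMeasurable (fun x => x ^ (-(2 / 3) : ℝ) * f x) (volume.restrict (Ioi 0)) :=
  ((continuousOn_id.rpow_const fun _ hx => Or.inl (ne_of_gt hx)).mul
    (hf.continuousOn.mono Ioi_subset_Ici_self)).aestronglyMeasurable measurableSet_Ioi

theorem IsProfile.integrableOn_rpow_mul (hf : IsProfile f) :
    IntegrableOn (fun x => x ^ (-(2 / 3) : ℝ) * f x) (Ioi 0) :=
  (integrableOn_majorant (f 0)).mono' hf.aestronglyMeasurable_rpow_mul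
    ((ae_restrict_mem measurableSet_Ioi).mono fun _ => hf.norm_rpow_mul_le_majorant le_rfl)

theorem IsProfile.integral_rpow_mul_pos (hf : IsProfile f) :
    0 < ∫ x in Ioi (0 : ℝ), x ^ (-(2 / 3) : ℝ) * f x := by
  have hnonneg : ∀ x ∈ Ioi (0 : ℝ), 0 ≤ x ^ (-(2 / 3) : ℝ) * f x := fun x (hx : 0 < x) =>
    mul_nonneg (Real.rpow_nonneg hx.le _) (hf.nonneg x hx.le)
  refine (setIntegral_nonneg measurableSet_Ioi hnonneg).lt_of_ne' fun hzero => ?_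
  rw [setIntegral_eq_zero_iff_of_nonneg_ae ((ae_restrict_mem measurableSet_Ioi).mono hnonneg)
    hf.integrableOn_rpow_mul] at hzero
  have hf0 : f =ᵐ[volume.restrict (Ioi 0)] 0 := by
    filter_upwards [hzero, ae_restrict_mem measurableSet_Ioi] with x hx hx0
    exact (mul_eq_zero.1 hx).resolve_left (Real.rpow_pos_of_pos hx0 _).ne'
  have hmass := hf.mass
  rw [integral_congr_ae hf0] at hmass
  simp at hmass

theorem intervalIntegrable_rpow_mul_sub (a : ℝ) :
    IntervalIntegrable (fun x => x ^ (-(2 / 3) : ℝ) * (a - x)) volume 0 a :=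
  (intervalIntegral.intervalIntegrable_rpow' (by norm_num)).mul_continuousOn (by fun_prop)

theorem integral_rpow_mul_sub (hP : 0 < P) :
    ∫ x in (0 : ℝ)..P ^ 3, x ^ (-(2 / 3) : ℝ) * (P ^ 3 - x) = 9 / 4 * P ^ 4 := by
  have hsplit : ∫ x in (0 : ℝ)..P ^ 3, x ^ (-(2 / 3) : ℝ) * (P ^ 3 - x) =
      ∫ x in (0 : ℝ)..P ^ 3, (P ^ 3 * x ^ (-(2 / 3) : ℝ) - x ^ (1 / 3 : ℝ)) := by
    refine intervalIntegral.integral_congr_ae (Eventually.of_forall fun x hx => ?_)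
    rw [uIoc_of_le (pow_pos hP 3).le] at hx
    rw [show (1 / 3 : ℝ) = -(2 / 3) + 1 by norm_num, Real.rpow_add_one hx.1.ne']
    ring
  have hcube : ∀ c : ℝ, (P ^ 3) ^ c = P ^ (3 * c) := fun c => by
    rw [← Real.rpow_natCast, ← Real.rpow_mul hP.le, Nat.cast_ofNat]
  rw [hsplit, intervalIntegral.integral_sub
    ((intervalIntegral.intervalIntegrable_rpow' (by norm_num)).const_mul _)
    (intervalIntegral.intervalIntegrable_rpow' (by norm_num)),
    intervalIntegral.integral_const_mul, integral_rpow (Or.inl (by norm_num)),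
    integral_rpow (Or.inl (by norm_num)), hcube, hcube, Real.zero_rpow (by norm_num),
    Real.zero_rpow (by norm_num)]
  norm_num
  ring

theorem IsProfile.mul_zero_le_integral_rpow_mul (hf : IsProfile f) (hs : IsStarConcave f)
    (hP : 0 < P) (hfP : 0 < f (P ^ 3)) :
    9 / 4 * P * f 0 ≤ ∫ x in Ioi (0 : ℝ), x ^ (-(2 / 3) : ℝ) * f x := by
  have hA : 0 < P ^ 3 := pow_pos hP 3
  have hint : IntervalIntegrable (fun x => x ^ (-(2 / 3) : ℝ) * f x) volume 0 (P ^ 3) :=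
    (intervalIntegrable_iff_integrableOn_Ioc_of_le hA.le).2
      (hf.integrableOn_rpow_mul.mono_set Ioc_subset_Ioi_self)
  have hchord : ∫ x in (0 : ℝ)..P ^ 3, f 0 * (x ^ (-(2 / 3) : ℝ) * (P ^ 3 - x)) ≤
      ∫ x in (0 : ℝ)..P ^ 3, P ^ 3 * (x ^ (-(2 / 3) : ℝ) * f x) := by
    refine intervalIntegral.integral_mono_on hA.le
      ((intervalIntegrable_rpow_mul_sub (P ^ 3)).const_mul _) (hint.const_mul _) fun x hx => ?_
    have := mul_le_mul_of_nonneg_left (hs le_rfl hx.1 hx.2 hfP)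
      (Real.rpow_nonneg hx.1 (-(2 / 3)))
    rw [sub_zero] at this
    linarith
  have htail : ∫ x in (0 : ℝ)..P ^ 3, x ^ (-(2 / 3) : ℝ) * f x ≤
      ∫ x in Ioi (0 : ℝ), x ^ (-(2 / 3) : ℝ) * f x := by
    rw [intervalIntegral.integral_of_le hA.le]
    exact setIntegral_mono_set hf.integrableOn_rpow_mul
      ((ae_restrict_mem measurableSet_Ioi).mono fun x (hx : 0 < x) =>
        mul_nonneg (Real.rpow_nonneg hx.le _) (hf.nonneg x hx.le)) Ioc_subset_Ioi_self.eventuallyLE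
  rw [intervalIntegral.integral_const_mul, intervalIntegral.integral_const_mul,
    integral_rpow_mul_sub hP] at hchord
  refine le_trans (le_of_mul_le_mul_left ?_ hA) htail
  linarith

theorem setIntegral_Ioi_eq_intervalIntegral (ha : 0 ≤ a) (hg : ∀ x, a < x → g x = 0) :
    ∫ x in Ioi (0 : ℝ), g x = ∫ x in (0 : ℝ)..a, g x := by
  rw [intervalIntegral.integral_of_le ha]
  exact setIntegral_eq_of_subset_of_forall_sdiff_eq_zero measurableSet_Ioi Ioc_subset_Ioi_self
    fun x hx => hg x (not_le.1 fun hxa => hx.2 ⟨hx.1, hxa⟩)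

theorem IsProfile.deriv_eq_zero_of_lt (hf : IsProfile f) (ha : supportEnd f = a) (hx : 0 < x)
    (hax : a < x) : deriv f x = 0 := by
  have hzero : f =ᶠ[𝓝 x] fun _ => 0 := by
    filter_upwards [Ioi_mem_nhds hx, Ioi_mem_nhds hax] with y hy hay
    exact hf.eq_zero_of_le ha (le_of_lt hy) (le_of_lt hay)
  rw [hzero.deriv_eq, deriv_const]

theorem IsProfile.intervalIntegrable_deriv (hf : IsProfile f) (ha : supportEnd f = a)
    (hd : ∀ x ∈ Ioo 0 a, DifferentiableAt ℝ f x) :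
    IntervalIntegrable (deriv f) volume 0 a := by
  have ha0 : 0 < a := (hf.pos_iff_lt ha le_rfl).1 hf.zero_pos
  have hneg : IntegrableOn (fun x => -deriv f x) (Ioc 0 a) :=
    intervalIntegral.integrableOn_deriv_of_nonneg
      (hf.continuousOn.mono Icc_subset_Ici_self).neg (fun x hx => (hd x hx).hasDerivAt.neg)
      fun x hx => neg_nonneg.2 (hf.deriv_nonpos hx.1)
  rw [intervalIntegrable_iff_integrableOn_Ioc_of_le ha0.le]
  exact hneg.neg.congr_fun (fun x _ => neg_neg _) measurableSet_Ioc

theorem IsProfile.integral_deriv (hf : IsProfile f) (ha : supportEnd f = a)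
    (hd : ∀ x ∈ Ioo 0 a, DifferentiableAt ℝ f x) : ∫ x in Ioi (0 : ℝ), deriv f x = -f 0 := by
  have ha0 : 0 < a := (hf.pos_iff_lt ha le_rfl).1 hf.zero_pos
  rw [setIntegral_Ioi_eq_intervalIntegral ha0.le fun x hx =>
    hf.deriv_eq_zero_of_lt ha (ha0.trans hx) hx,
    intervalIntegral.integral_eq_sub_of_hasDerivAt_of_le ha0.le
      (hf.continuousOn.mono Icc_subset_Ici_self) (fun x hx => (hd x hx).hasDerivAt)
      (hf.intervalIntegrable_deriv ha hd), hf.eq_zero_of_le ha ha0.le le_rfl, zero_sub]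

theorem IsProfile.integral_mul_deriv (hf : IsProfile f) (ha : supportEnd f = a)
    (hd : ∀ x ∈ Ioo 0 a, DifferentiableAt ℝ f x) : ∫ x in Ioi (0 : ℝ), x * deriv f x = -1 := by
  have ha0 : 0 < a := (hf.pos_iff_lt ha le_rfl).1 hf.zero_pos
  have hparts := intervalIntegral.integral_mul_deriv_eq_deriv_mul_of_hasDerivAt (a := 0) (b := a)
    (u := fun x => x) (v := f) (u' := fun _ => 1) (v' := deriv f) continuousOn_id
    (uIcc_of_le ha0.le ▸ hf.continuousOn.mono Icc_subset_Ici_self) (fun x _ => hasDerivAt_id x)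
    (fun x hx => (hd x (by simpa [ha0.le] using hx)).hasDerivAt)
    intervalIntegrable_const (hf.intervalIntegrable_deriv ha hd)
  have hmass : ∫ x in (0 : ℝ)..a, f x = 1 := by
    rw [← setIntegral_Ioi_eq_intervalIntegral ha0.le fun x hx =>
      hf.eq_zero_of_le ha (ha0.trans hx).le hx.le, hf.mass]
  rw [setIntegral_Ioi_eq_intervalIntegral ha0.le fun x hx => by
    rw [hf.deriv_eq_zero_of_lt ha (ha0.trans hx) hx, mul_zero], hparts,
    hf.eq_zero_of_le ha ha0.le le_rfl]
  simp [hmass]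

end Moments

/-- The cube root of the parameter `L(t)`. -/
noncomputable def scaleRoot (w : ℝ → ℝ → ℝ) (t : ℝ) : ℝ :=
  (1 / 3 : ℝ) * (∫ x in Ioi (0 : ℝ), x ^ (-(2 / 3) : ℝ) * w x t) / w 0 t

namespace IsSolution

variable {w₀ : ℝ → ℝ} {w : ℝ → ℝ → ℝ} {p r P : ℝ → ℝ}
  {a ε δ k q s t T T₀ x z : ℝ}

section Transport

theorem continuousOn_time (h : IsSolution w₀ w) (hx : 0 ≤ x) :
    ContinuousOn (fun t => w x t) (Ici 0) :=
  h.continuousOn.comp (f := fun t : ℝ => (x, t)) (by fun_prop) fun _ ht => ⟨hx, ht⟩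

theorem isProfile (h : IsSolution w₀ w) (ht : 0 ≤ t) : IsProfile fun x => w x t where
  continuousOn := h.continuousOn.comp (f := fun x : ℝ => (x, t)) (by fun_prop)
    fun _ hx => ⟨hx, ht⟩
  nonneg x hx := h.nonneg x t hx ht
  antitoneOn := h.antitoneOn t ht
  integrableOn := h.integrableOn t ht
  mass := h.mass t ht

theorem isProfile_initial (h : IsSolution w₀ w) : IsProfile w₀ where
  continuousOn := (h.isProfile le_rfl).continuousOn.congr fun x hx => (h.initial x hx).symm
  nonneg x hx := h.initial x hx ▸ h.nonneg x 0 hx le_rfl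
  antitoneOn := (h.antitoneOn 0 le_rfl).congr h.initial
  integrableOn := (h.integrableOn 0 le_rfl).congr_fun
    (fun x hx => h.initial x (le_of_lt hx)) measurableSet_Ioi
  mass := (setIntegral_congr_fun measurableSet_Ioi
    fun x hx => (h.initial x (le_of_lt hx)).symm).trans (h.mass 0 le_rfl)

theorem scaleRoot_pos (h : IsSolution w₀ w) (ht : 0 ≤ t) : 0 < scaleRoot w t :=
  div_pos (mul_pos (by norm_num) (h.isProfile ht).integral_rpow_mul_pos) (h.isProfile ht).zero_pos

theorem continuousOn_scaleRoot (h : IsSolution w₀ w) (T : ℝ) :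
    ContinuousOn (scaleRoot w) (Icc 0 T) := by
  have hzero := (h.continuousOn_time le_rfl).mono (Icc_subset_Ici_self : Icc 0 T ⊆ Ici 0)
  obtain ⟨M, hM⟩ := isCompact_Icc.bddAbove_image hzero
  refine ContinuousOn.div (continuousOn_const.mul ?_) hzero
    fun s hs => (h.isProfile hs.1).zero_pos.ne'
  refine continuousOn_of_dominated (bound := majorant M)
    (fun t ht => (h.isProfile ht.1).aestronglyMeasurable_rpow_mul)
    (fun t ht => (ae_restrict_mem measurableSet_Ioi).mono fun x hx =>
      (h.isProfile ht.1).norm_rpow_mul_le_majorant (hM (mem_image_of_mem _ ht)) hx)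
    (integrableOn_majorant M) ?_
  exact (ae_restrict_mem measurableSet_Ioi).mono fun x hx =>
    continuousOn_const.mul ((h.continuousOn_time (le_of_lt hx)).mono Icc_subset_Ici_self)

theorem exists_isCharacteristic (h : IsSolution w₀ w) (hT : 0 ≤ T) (hx : 0 < x) :
    ∃ p, IsCharacteristic (scaleRoot w) T p ∧ p T ^ 3 = x := by
  obtain ⟨p, hp, hpT⟩ := IsCharacteristic.exists_of_continuousOn hT (h.continuousOn_scaleRoot T)
    (fun _ hs => h.scaleRoot_pos hs.1) (Real.rpow_pos_of_pos hx (((3 : ℕ) : ℝ)⁻¹))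
  exact ⟨p, hp, hpT ▸ Real.rpow_inv_natCast_pow hx.le three_ne_zero⟩

theorem characteristic_lt (h : IsSolution w₀ w) (hp : IsCharacteristic (scaleRoot w) T p)
    (hr : IsCharacteristic (scaleRoot w) T r) (hlt : p T ^ 3 < r T ^ 3) (hs : s ∈ Icc 0 T) :
    p s < r s :=
  hp.lt_of_lt hr (h.continuousOn_scaleRoot T) (fun _ hs => h.scaleRoot_pos hs.1)
    ((hp.cube_lt_cube_iff hr ⟨hs.1.trans hs.2, le_rfl⟩).1 hlt) hs

theorem differentiableAt_space (h : IsSolution w₀ w) (hx : 0 < x) (ht : 0 < t) (hw : 0 < w x t) :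
    DifferentiableAt ℝ (fun y => w y t) x :=
  (h.differentiableAt x t hx ht hw).comp (f := fun y : ℝ => (y, t)) x (by fun_prop)

theorem hasDerivAt_time (h : IsSolution w₀ w) (hq : 0 < q) (ht : 0 < t) (hw : 0 < w (q ^ 3) t) :
    HasDerivAt (fun s => w (q ^ 3) s)
      ((1 - q / scaleRoot w t) * deriv (fun y => w y t) (q ^ 3)) t := by
  have hq3 : 0 < q ^ 3 := pow_pos hq 3
  have hd : DifferentiableAt ℝ (fun s => w (q ^ 3) s) t :=
    (h.differentiableAt _ t hq3 ht hw).comp (f := fun s : ℝ => (q ^ 3, s)) t (by fun_prop)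
  have hroot : (q ^ 3 / scale w t) ^ (1 / 3 : ℝ) = q / scaleRoot w t := by
    have hscale : scale w t = scaleRoot w t ^ 3 := rfl
    rw [hscale, ← div_pow, one_div, ← Nat.cast_ofNat (R := ℝ),
      Real.pow_rpow_inv_natCast (div_pos hq (h.scaleRoot_pos ht.le)).le three_ne_zero]
  rw [← hroot, ← h.transport _ t hq3 ht hw]
  exact hd.hasDerivAt

theorem hasDerivAt_characteristic (h : IsSolution w₀ w)
    (hp : IsCharacteristic (scaleRoot w) T p) (hs : s ∈ Ioo 0 T) (hw : 0 < w (p s ^ 3) s) :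
    HasDerivAt (fun s => w (p s ^ 3) s) 0 s := by
  have hs' := Ioo_subset_Icc_self hs
  have hfderiv := (h.differentiableAt _ s (hp.cube_pos hs') hs.1 hw).hasFDerivAt
  have hspace : HasDerivAt (fun y => w y s)
      (fderiv ℝ (fun u : ℝ × ℝ => w u.1 u.2) (p s ^ 3, s) (1, 0)) (p s ^ 3) :=
    hfderiv.comp_hasDerivAt (f := fun y : ℝ => (y, s)) (p s ^ 3)
      ((hasDerivAt_id _).prodMk (hasDerivAt_const _ s))
  have htime := hfderiv.comp_hasDerivAt (f := fun u : ℝ => (p s ^ 3, u)) s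
    ((hasDerivAt_const s _).prodMk (hasDerivAt_id s))
  have htransport := htime.unique (h.hasDerivAt_time (hp.pos s hs') hs.1 hw)
  rw [hspace.deriv] at htransport
  have hdir : ((-1 + p s / scaleRoot w s, 1) : ℝ × ℝ) =
      (-1 + p s / scaleRoot w s) • ((1, 0) : ℝ × ℝ) + (0, 1) := by simp
  refine (hfderiv.comp_hasDerivAt (f := fun s : ℝ => (p s ^ 3, s)) s
    ((hp.hasDerivAt_cube hs).prodMk (hasDerivAt_id s))).congr_deriv ?_
  rw [hdir, map_add, map_smul, htransport, smul_eq_mul]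
  ring

theorem eq_of_isCharacteristic (h : IsSolution w₀ w) (hp : IsCharacteristic (scaleRoot w) T p)
    (hw : 0 < w (p T ^ 3) T) (hs : s ∈ Icc 0 T) : w (p s ^ 3) s = w (p T ^ 3) T :=
  eq_of_hasDerivAt_zero_of_pos
    (h.continuousOn.comp (f := fun s : ℝ => (p s ^ 3, s))
      (hp.continuousOn_cube.prodMk continuousOn_id) fun _ hu => ⟨(hp.cube_pos hu).le, hu.1⟩)
    (fun _ hu => h.hasDerivAt_characteristic hp hu) hw hs

theorem initial_eq (h : IsSolution w₀ w) (hT : 0 ≤ T) (hp : IsCharacteristic (scaleRoot w) T p)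
    (hw : 0 < w (p T ^ 3) T) : w₀ (p 0 ^ 3) = w (p T ^ 3) T := by
  have h0 := left_mem_Icc.2 hT
  rw [← h.initial _ (hp.cube_pos h0).le, h.eq_of_isCharacteristic hp hw h0]

end Transport

section StarConcave

theorem mul_sub_le_of_pos (h : IsSolution w₀ w) (hs : IsStarConcave w₀) (ht : 0 ≤ t) {y A : ℝ}
    (hy : 0 < y) (hyz : y < z) (hzA : z < A) (hw : 0 < w A t) :
    w y t * (A - z) ≤ w z t * (A - y) := by
  obtain ⟨p, hp, rfl⟩ := h.exists_isCharacteristic ht hy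
  obtain ⟨r, hr, rfl⟩ := h.exists_isCharacteristic ht (hy.trans hyz)
  obtain ⟨P, hP, rfl⟩ := h.exists_isCharacteristic ht (hy.trans (hyz.trans hzA))
  have h0 := left_mem_Icc.2 ht
  have ht' := right_mem_Icc.2 ht
  have hpr : ∀ s ∈ Icc 0 t, p s < r s := fun s => h.characteristic_lt hp hr hyz
  have hrP : ∀ s ∈ Icc 0 t, r s < P s := fun s => h.characteristic_lt hr hP hzA
  have hpr0 := (hp.cube_lt_cube_iff hr h0).2 (hpr 0 h0)
  have hrP0 := (hr.cube_lt_cube_iff hP h0).2 (hrP 0 h0)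
  have hanti := h.antitoneOn t ht
  have hwz : 0 < w (r t ^ 3) t := hw.trans_le
    (hanti (hr.cube_pos ht').le (hP.cube_pos ht').le hzA.le)
  have hwy : 0 < w (p t ^ 3) t := hwz.trans_le
    (hanti (hp.cube_pos ht').le (hr.cube_pos ht').le hyz.le)
  have hflow := hp.sub_mul_sub_le_of_lt ht hr hP (fun s hs => h.scaleRoot_pos hs.1) hpr hrP
  have hstar := hs (hp.cube_pos h0).le hpr0.le hrP0.le ((h.initial_eq ht hP hw).symm ▸ hw)
  rw [h.initial_eq ht hp hwy, h.initial_eq ht hr hwz] at hstar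
  refine le_of_mul_le_mul_right ?_ (sub_pos.2 (hpr0.trans hrP0))
  have hflow' := mul_le_mul_of_nonneg_left hflow hwy.le
  have hstar' := mul_le_mul_of_nonneg_right hstar (sub_pos.2 (hyz.trans hzA)).le
  linarith

theorem isStarConcave (h : IsSolution w₀ w) (hs : IsStarConcave w₀) (ht : 0 ≤ t) :
    IsStarConcave fun x => w x t := by
  intro y z A hy hyz hzA hw
  rcases hzA.eq_or_lt with rfl | hzA
  · simpa using mul_nonneg hw.le (sub_nonneg.2 hyz)
  rcases hyz.eq_or_lt with rfl | hyz
  · exact le_rfl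
  rcases hy.eq_or_lt with rfl | hy
  · refine le_of_tendsto_of_tendsto (b := 𝓝[>] 0) (f := fun y => w y t * (A - z))
      (g := fun y => w z t * (A - y)) ?_ ?_ ?_
    · exact (((h.isProfile ht).continuousOn 0 self_mem_Ici).mono
        Ioi_subset_Ici_self).tendsto.mul_const _
    · exact (Continuous.tendsto (by fun_prop) 0).mono_left nhdsWithin_le_nhds
    · filter_upwards [Ioo_mem_nhdsGT hyz] with y hy
      exact h.mul_sub_le_of_pos hs ht hy.1 hy.2 hzA hw
  · exact h.mul_sub_le_of_pos hs ht hy hyz hzA hw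

theorem le_scaleRoot (h : IsSolution w₀ w) (hs : IsStarConcave w₀) (ht : 0 ≤ t) (hq : 0 < q)
    (hw : 0 < w (q ^ 3) t) : q ≤ 4 / 3 * scaleRoot w t := by
  have hle := (h.isProfile ht).mul_zero_le_integral_rpow_mul (h.isStarConcave hs ht) hq hw
  rw [scaleRoot, ← mul_div_assoc, le_div_iff₀ (h.isProfile ht).zero_pos]
  linarith

theorem characteristic_le_scaleRoot (h : IsSolution w₀ w) (hs : IsStarConcave w₀)
    (hP : IsCharacteristic (scaleRoot w) T P) (hw : 0 < w (P T ^ 3) T) (ht : t ∈ Icc 0 T) :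
    P t ≤ 4 / 3 * scaleRoot w t :=
  h.le_scaleRoot hs ht.1 (hP.pos t ht) (by rwa [h.eq_of_isCharacteristic hP hw ht])

theorem cube_mul_le_two (h : IsSolution w₀ w) (hs : IsStarConcave w₀)
    (hp : IsCharacteristic (scaleRoot w) T p) (hP : IsCharacteristic (scaleRoot w) T P)
    (hwp : 0 < w (p T ^ 3) T) (hwP : 0 < w (P T ^ 3) T) (ht : t ∈ Icc 0 T) :
    P t ^ 3 * w (p T ^ 3) T ≤ 2 := by
  have hP3 := (hP.cube_pos ht).le
  have hp3 := (hp.cube_pos ht).le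
  rw [← h.eq_of_isCharacteristic hp hwp ht]
  exact (mul_le_mul_of_nonneg_left (h.antitoneOn t ht.1 self_mem_Ici hp3 hp3) hP3).trans
    ((h.isProfile ht.1).mul_zero_le_two (h.isStarConcave hs ht.1) hP3
      (by rwa [h.eq_of_isCharacteristic hP hwP ht]))

theorem meanVolume_eq_inv (h : IsSolution w₀ w) (hs : IsStarConcave w₀) (ht : 0 < t) :
    meanVolume w t = (w 0 t)⁻¹ := by
  have hf := h.isProfile ht.le
  obtain ⟨e, -, he⟩ := hf.exists_supportEnd_eq (h.isStarConcave hs ht.le)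
  have hd : ∀ x ∈ Ioo 0 e, DifferentiableAt ℝ (fun y => w y t) x := fun x hx =>
    h.differentiableAt_space hx.1 ht ((hf.pos_iff_lt he hx.1.le).2 hx.2)
  simp only [meanVolume, density, mul_neg, integral_neg, hf.integral_deriv he hd,
    hf.integral_mul_deriv he hd, neg_neg, one_div]

end StarConcave

section Decay

theorem start_lt (h : IsSolution w₀ w) (ha : supportEnd w₀ = a) (hT : 0 ≤ T)
    (hp : IsCharacteristic (scaleRoot w) T p) (hw : 0 < w (p T ^ 3) T) : p 0 ^ 3 < a :=
  (h.isProfile_initial.pos_iff_lt ha (hp.cube_pos (left_mem_Icc.2 hT)).le).1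
    (h.initial_eq hT hp hw ▸ hw)

theorem exists_isCharacteristic_above (h : IsSolution w₀ w) (ha : supportEnd w₀ = a) (hT : 0 ≤ T)
    (hp : IsCharacteristic (scaleRoot w) T p) (hw : 0 < w (p T ^ 3) T) :
    ∃ P, IsCharacteristic (scaleRoot w) T P ∧ 0 < w (P T ^ 3) T ∧
      (∀ s ∈ Icc 0 T, p s < P s) ∧ (a - p 0 ^ 3) / 2 ≤ P 0 ^ 3 - p 0 ^ 3 := by
  have h0 := left_mem_Icc.2 hT
  have hp0 := hp.cube_pos h0
  have hpa := h.start_lt ha hT hp hw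
  have hmid0 : 0 ≤ (a + p 0 ^ 3) / 2 := by linarith
  have hmid : 0 < w₀ ((a + p 0 ^ 3) / 2) :=
    (h.isProfile_initial.pos_iff_lt ha hmid0).2 (by linarith)
  obtain ⟨x, hx, hwx, hxmin⟩ := (h.isProfile hT).exists_pos_lt (lt_min hw hmid)
  obtain ⟨hxp, hxmid⟩ := lt_min_iff.1 hxmin
  obtain ⟨P, hP, rfl⟩ := h.exists_isCharacteristic hT hx
  have hpx : p T ^ 3 < P T ^ 3 := lt_of_not_ge fun hle => hxp.not_ge
    (h.antitoneOn T hT hx.le (hp.cube_pos (right_mem_Icc.2 hT)).le hle)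
  have hstart : (a + p 0 ^ 3) / 2 < P 0 ^ 3 := lt_of_not_ge fun hle => by
    have hge := h.isProfile_initial.antitoneOn (hP.cube_pos h0).le hmid0 hle
    rw [h.initial_eq hT hP hwx] at hge
    exact hxmid.not_ge hge
  exact ⟨P, hP, hwx, fun s => h.characteristic_lt hp hP hpx, by linarith⟩

theorem sub_lt_start (h : IsSolution w₀ w) (hs : IsStarConcave w₀) (ha : supportEnd w₀ = a)
    (hT : 0 ≤ T) (hlate : 2 * a * Real.exp (-(ε / a ^ 2 / 18 * T)) < ε)
    (hp : IsCharacteristic (scaleRoot w) T p) (hw : 0 < w (p T ^ 3) T) : a - ε < p 0 ^ 3 := by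
  have hp0 := hp.cube_pos (left_mem_Icc.2 hT)
  have hpa := h.start_lt ha hT hp hw
  have ha0 := hp0.trans hpa
  rcases lt_or_ge (w (p T ^ 3) T) (ε / a ^ 2) with hsmall | hlarge
  · have hend := h.isProfile_initial.sub_le_sq_mul hs ha hp0.le hpa
    rw [h.initial_eq hT hp hw] at hend
    rw [lt_div_iff₀' (by positivity)] at hsmall
    linarith
  · obtain ⟨P, hP, hwP, hpP, hhalf⟩ := h.exists_isCharacteristic_above ha hT hp hw
    have hcontract := hp.sub_le_mul_exp hT hP (fun s hs => h.scaleRoot_pos hs.1) hpP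
      (fun s => h.characteristic_le_scaleRoot hs hP hwP) (κ := ε / a ^ 2) fun s hs' =>
        (mul_le_mul_of_nonneg_left hlarge (hP.cube_pos hs').le).trans
          (h.cube_mul_le_two hs hp hP hw hwP hs')
    have hPa := mul_le_mul_of_nonneg_right (h.start_lt ha hT hP hwP).le
      (Real.exp_nonneg (-(ε / a ^ 2 / 18 * T)))
    linarith

theorem sub_mul_sub_mul_le (h : IsSolution w₀ w) (hs : IsStarConcave w₀) (ha : supportEnd w₀ = a)
    (hT : 0 ≤ T) (hp : IsCharacteristic (scaleRoot w) T p) (hr : IsCharacteristic (scaleRoot w) T r)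
    (hpr : p T ^ 3 < r T ^ 3) (hw : 0 < w (p T ^ 3) T) :
    (r T ^ 3 - p T ^ 3) * (a - p 0 ^ 3) * w (p T ^ 3) T ≤ 4 * Real.exp 6 * (r 0 ^ 3 - p 0 ^ 3) := by
  have h0 := left_mem_Icc.2 hT
  have hT' := right_mem_Icc.2 hT
  have hpr' : ∀ s ∈ Icc 0 T, p s < r s := fun s => h.characteristic_lt hp hr hpr
  obtain ⟨P, hP, hwP, hpP, hhalf⟩ := h.exists_isCharacteristic_above ha hT hp hw
  have hflow := hp.sub_mul_sub_le hT hr hP (fun s hs => h.scaleRoot_pos hs.1) hpr' hpP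
    fun s => h.characteristic_le_scaleRoot hs hP hwP
  have hmass : (P T ^ 3 - p T ^ 3) * w (p T ^ 3) T ≤ 2 :=
    (mul_le_mul_of_nonneg_right (sub_le_self _ (hp.cube_pos hT').le) hw.le).trans
      (h.cube_mul_le_two hs hp hP hw hwP hT')
  have hD : 0 ≤ r T ^ 3 - p T ^ 3 := (sub_pos.2 hpr).le
  have hD0 : 0 ≤ r 0 ^ 3 - p 0 ^ 3 := (sub_pos.2 ((hp.cube_lt_cube_iff hr h0).2 (hpr' 0 h0))).le
  calc (r T ^ 3 - p T ^ 3) * (a - p 0 ^ 3) * w (p T ^ 3) T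
      = 2 * ((r T ^ 3 - p T ^ 3) * ((a - p 0 ^ 3) / 2) * w (p T ^ 3) T) := by ring
    _ ≤ 2 * (Real.exp 6 * ((r 0 ^ 3 - p 0 ^ 3) * (P T ^ 3 - p T ^ 3)) * w (p T ^ 3) T) :=
      mul_le_mul_of_nonneg_left (mul_le_mul_of_nonneg_right
        ((mul_le_mul_of_nonneg_left hhalf hD).trans hflow) hw.le) two_pos.le
    _ = 2 * Real.exp 6 * (r 0 ^ 3 - p 0 ^ 3) * ((P T ^ 3 - p T ^ 3) * w (p T ^ 3) T) := by ring
    _ ≤ 2 * Real.exp 6 * (r 0 ^ 3 - p 0 ^ 3) * 2 := by gcongr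
    _ = 4 * Real.exp 6 * (r 0 ^ 3 - p 0 ^ 3) := by ring

theorem mul_sub_le_inv_sub_inv (h : IsSolution w₀ w) (hs : IsStarConcave w₀)
    (ha : supportEnd w₀ = a) (hδ : 0 ≤ δ) (hdecay : HasEndDecay w₀ a ε δ) (hT : 0 ≤ T)
    (hlate : 2 * a * Real.exp (-(ε / a ^ 2 / 18 * T)) < ε) (hx : 0 < x) (hxz : x < z)
    (hw : 0 < w z T) : δ / (4 * Real.exp 6) * (z - x) ≤ (w z T)⁻¹ - (w x T)⁻¹ := by
  have hwx : 0 < w x T := hw.trans_le (h.antitoneOn T hT hx.le (hx.trans hxz).le hxz.le)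
  obtain ⟨p, hp, rfl⟩ := h.exists_isCharacteristic hT hx
  obtain ⟨r, hr, rfl⟩ := h.exists_isCharacteristic hT (hx.trans hxz)
  have h0 := left_mem_Icc.2 hT
  have hstart := (hp.cube_lt_cube_iff hr h0).2 (h.characteristic_lt hp hr hxz h0)
  have hgap : 0 < a - p 0 ^ 3 := sub_pos.2 (h.start_lt ha hT hp hwx)
  have hinitial := hdecay (hp.cube_pos h0) (h.sub_lt_start hs ha hT hlate hp hwx) hstart.le
    (h.start_lt ha hT hr hw)
  rw [h.initial_eq hT hp hwx, h.initial_eq hT hr hw] at hinitial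
  have hdisplacement := h.sub_mul_sub_mul_le hs ha hT hp hr hxz hwx
  rw [inv_sub_inv hw.ne' hwx.ne', div_mul_eq_mul_div,
    div_le_div_iff₀ (by positivity) (mul_pos hw hwx)]
  refine le_of_mul_le_mul_right ?_ hgap
  calc δ * (r T ^ 3 - p T ^ 3) * (w (r T ^ 3) T * w (p T ^ 3) T) * (a - p 0 ^ 3)
      = δ * w (r T ^ 3) T *
          ((r T ^ 3 - p T ^ 3) * (a - p 0 ^ 3) * w (p T ^ 3) T) := by ring
    _ ≤ δ * w (r T ^ 3) T * (4 * Real.exp 6 * (r 0 ^ 3 - p 0 ^ 3)) := by gcongr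
    _ = 4 * Real.exp 6 * (δ * w (r T ^ 3) T * (r 0 ^ 3 - p 0 ^ 3)) := by ring
    _ ≤ 4 * Real.exp 6 * ((w (p T ^ 3) T - w (r T ^ 3) T) * (a - p 0 ^ 3)) := by gcongr
    _ = (w (p T ^ 3) T - w (r T ^ 3) T) * (4 * Real.exp 6) * (a - p 0 ^ 3) := by ring

theorem mul_sq_le_density (h : IsSolution w₀ w) (hs : IsStarConcave w₀) (ha : supportEnd w₀ = a)
    (hδ : 0 ≤ δ) (hdecay : HasEndDecay w₀ a ε δ) (hT : 0 < T)
    (hlate : 2 * a * Real.exp (-(ε / a ^ 2 / 18 * T)) < ε) (hx : 0 < x) (hw : 0 < w x T) :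
    δ / (4 * Real.exp 6) * w x T ^ 2 ≤ density w x T := by
  have hd := (h.differentiableAt_space hx hT hw).hasDerivAt
  have hinv := (hd.fun_inv hw.ne').hasDerivWithinAt (s := Ioi x)
  rw [hasDerivWithinAt_iff_tendsto_slope' self_notMem_Ioi] at hinv
  refine (le_div_iff₀ (by positivity)).1 (ge_of_tendsto hinv ?_)
  filter_upwards [nhdsWithin_le_nhds (hd.continuousAt.eventually_const_lt hw),
    self_mem_nhdsWithin] with z hz hxz
  rw [slope_def_field, le_div_iff₀ (sub_pos.2 hxz)]
  exact h.mul_sub_le_inv_sub_inv hs ha hδ hdecay hT.le hlate hx hxz hz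

end Decay

section Growth

theorem exists_forall_pos (h : IsSolution w₀ w) (hT : 0 ≤ T) :
    ∃ e, 0 < e ∧ ∀ q ∈ Ioo 0 e, ∀ t ∈ Icc 0 T, 0 < w (q ^ 3) t := by
  obtain ⟨x, hx, hwx, -⟩ := (h.isProfile hT).exists_pos_lt one_pos
  obtain ⟨P, hP, rfl⟩ := h.exists_isCharacteristic hT hx
  obtain ⟨s, hs, hmin⟩ := isCompact_Icc.exists_isMinOn (nonempty_Icc.2 hT) hP.continuousOn
  refine ⟨P s, hP.pos s hs, fun q hq t ht => ?_⟩
  refine (hwx.trans_eq (h.eq_of_isCharacteristic hP hwx ht).symm).trans_le ?_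
  exact h.antitoneOn t ht.1 (pow_pos hq.1 3).le (hP.cube_pos ht).le
    (pow_le_pow_left₀ hq.1.le (hq.2.le.trans (hmin ht)) 3)

theorem mul_one_sub_mul_sub_le_inv (h : IsSolution w₀ w) (hk : 0 ≤ k) (hT₀ : 0 ≤ T₀) (hT : T₀ ≤ T)
    (hdensity : ∀ t x, T₀ < t → 0 < x → 0 < w x t → k * w x t ^ 2 ≤ density w x t) {m : ℝ}
    (hm : ∀ t ∈ Icc 0 T, m ≤ scaleRoot w t) (hq : 0 < q) (hqm : q < m)
    (hpos : ∀ t ∈ Icc 0 T, 0 < w (q ^ 3) t) : k * (1 - q / m) * (T - T₀) ≤ (w (q ^ 3) T)⁻¹ := by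
  have hm0 : 0 < m := hq.trans hqm
  have hsub : Icc T₀ T ⊆ Icc 0 T := Icc_subset_Icc_left hT₀
  have hd : ∀ t ∈ Ioo T₀ T, HasDerivAt (fun t => (w (q ^ 3) t)⁻¹)
      (-((1 - q / scaleRoot w t) * deriv (fun y => w y t) (q ^ 3)) / w (q ^ 3) t ^ 2) t :=
    fun t ht => (h.hasDerivAt_time hq (hT₀.trans_lt ht.1)
      (hpos t (hsub (Ioo_subset_Icc_self ht)))).fun_inv (hpos t (hsub (Ioo_subset_Icc_self ht))).ne'
  have hgrowth : ∀ t ∈ Ioo T₀ T, k * (1 - q / m) ≤ deriv (fun t => (w (q ^ 3) t)⁻¹) t := by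
    intro t ht
    have ht' := hsub (Ioo_subset_Icc_self ht)
    have hw := hpos t ht'
    have hratio : q / scaleRoot w t ≤ q / m := div_le_div_of_nonneg_left hq.le hm0 (hm t ht')
    have hqm' : 0 ≤ 1 - q / m := sub_nonneg.2 ((div_le_one hm0).2 hqm.le)
    rw [(hd t ht).deriv, le_div_iff₀ (pow_pos hw 2), ← mul_neg]
    calc k * (1 - q / m) * w (q ^ 3) t ^ 2 = (1 - q / m) * (k * w (q ^ 3) t ^ 2) := by ring
      _ ≤ (1 - q / scaleRoot w t) * density w (q ^ 3) t :=
        mul_le_mul (sub_le_sub_left hratio 1) (hdensity t _ ht.1 (pow_pos hq 3) hw)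
          (by positivity) (hqm'.trans (sub_le_sub_left hratio 1))
  have hcont : ContinuousOn (fun t => (w (q ^ 3) t)⁻¹) (Icc T₀ T) :=
    ((h.continuousOn_time (pow_pos hq 3).le).mono fun t ht => (hsub ht).1).inv₀
      fun t ht => (hpos t (hsub ht)).ne'
  have hmean := (convex_Icc T₀ T).mul_sub_le_image_sub_of_le_deriv hcont
    (by rw [interior_Icc]; exact fun t ht => (hd t ht).differentiableAt.differentiableWithinAt)
    (by rwa [interior_Icc]) T₀ (left_mem_Icc.2 hT) T (right_mem_Icc.2 hT) hT
  exact hmean.trans (sub_le_self _ (inv_pos.2 (hpos T₀ (hsub (left_mem_Icc.2 hT)))).le)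

theorem mul_sub_le_inv (h : IsSolution w₀ w) (hk : 0 ≤ k) (hT₀ : 0 ≤ T₀) (hT : T₀ ≤ T)
    (hdensity : ∀ t x, T₀ < t → 0 < x → 0 < w x t → k * w x t ^ 2 ≤ density w x t) :
    k * (T - T₀) ≤ (w 0 T)⁻¹ := by
  have hT' := hT₀.trans hT
  obtain ⟨e, he, hpos⟩ := h.exists_forall_pos hT'
  obtain ⟨s, hs, hmin⟩ :=
    isCompact_Icc.exists_isMinOn (nonempty_Icc.2 hT') (h.continuousOn_scaleRoot T)
  have hleft : Tendsto (fun q => k * (1 - q / scaleRoot w s) * (T - T₀)) (𝓝[>] 0)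
      (𝓝 (k * (1 - 0 / scaleRoot w s) * (T - T₀))) :=
    (Continuous.tendsto (by fun_prop) 0).mono_left nhdsWithin_le_nhds
  have hcube : Tendsto (fun q : ℝ => q ^ 3) (𝓝[>] 0) (𝓝[≥] 0) := by
    refine tendsto_nhdsWithin_iff.2 ⟨?_, eventually_nhdsWithin_of_forall fun q hq =>
      mem_Ici.2 (pow_pos (mem_Ioi.1 hq) 3).le⟩
    exact ((continuous_pow 3).tendsto' 0 0 (zero_pow three_ne_zero)).mono_left nhdsWithin_le_nhds
  have hright : Tendsto (fun q => (w (q ^ 3) T)⁻¹) (𝓝[>] 0) (𝓝 (w 0 T)⁻¹) :=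
    (((h.isProfile hT').continuousOn 0 self_mem_Ici).tendsto.comp hcube).inv₀
      (h.isProfile hT').zero_pos.ne'
  rw [zero_div, sub_zero, mul_one] at hleft
  refine le_of_tendsto_of_tendsto hleft hright ?_
  filter_upwards [Ioo_mem_nhdsGT (lt_min he (h.scaleRoot_pos hs.1))] with q hq
  obtain ⟨hqe, hqs⟩ := lt_min_iff.1 hq.2
  exact h.mul_one_sub_mul_sub_le_inv hk hT₀ hT hdensity (fun t ht => hmin ht) hq.1 hqs
    (hpos q ⟨hq.1, hqe⟩)

theorem zero_le_initial (h : IsSolution w₀ w) (hT : 0 ≤ T) : w 0 T ≤ w₀ 0 := by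
  have hlim : Tendsto (fun x => w x T) (𝓝[>] 0) (𝓝 (w 0 T)) :=
    ((h.isProfile hT).continuousOn 0 self_mem_Ici).mono Ioi_subset_Ici_self
  refine le_of_tendsto hlim ?_
  filter_upwards [hlim.eventually_const_lt (h.isProfile hT).zero_pos, self_mem_nhdsWithin]
    with x hwx hx
  obtain ⟨p, hp, rfl⟩ := h.exists_isCharacteristic hT hx
  have hp0 := (hp.cube_pos (left_mem_Icc.2 hT)).le
  exact (h.initial_eq hT hp hwx).symm.trans_le (h.isProfile_initial.antitoneOn self_mem_Ici hp0 hp0)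

theorem half_supportEnd_le_meanVolume (h : IsSolution w₀ w) (hs : IsStarConcave w₀)
    (ha : supportEnd w₀ = a) (hT : 0 < T) : a / 2 ≤ meanVolume w T := by
  have ha0 : 0 ≤ a := ((h.isProfile_initial.pos_iff_lt ha le_rfl).1 h.isProfile_initial.zero_pos).le
  rw [h.meanVolume_eq_inv hs hT, ← one_div, div_le_div_iff₀ two_pos (h.isProfile hT.le).zero_pos,
    one_mul]
  exact (mul_le_mul_of_nonneg_left (h.zero_le_initial hT.le) ha0).trans
    (h.isProfile_initial.supportEnd_mul_zero_le_two hs ha)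

theorem mul_sub_le_meanVolume (h : IsSolution w₀ w) (hs : IsStarConcave w₀) (ha : supportEnd w₀ = a)
    (hδ : 0 ≤ δ) (hdecay : HasEndDecay w₀ a ε δ) (hT₀ : 0 < T₀)
    (hlate : ∀ t, T₀ ≤ t → 2 * a * Real.exp (-(ε / a ^ 2 / 18 * t)) < ε) (hT : T₀ ≤ T) :
    δ / (4 * Real.exp 6) * (T - T₀) ≤ meanVolume w T := by
  rw [h.meanVolume_eq_inv hs (hT₀.trans_le hT)]
  exact h.mul_sub_le_inv (by positivity) hT₀.le hT fun t x ht hx hw =>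
    h.mul_sq_le_density hs ha hδ hdecay (hT₀.trans ht) (hlate t ht.le) hx hw

end Growth

end IsSolution

theorem exists_pos_forall_le_of_liminf {a : ℝ} {b : ℝ → ℝ}
    (hb : 0 < liminf (fun x : ℝ => (b x : EReal)) (leftOf (a : EReal))) :
    ∃ ε δ : ℝ, 0 < ε ∧ 0 < δ ∧ ∀ x, a - ε < x → x < a → δ ≤ b x := by
  obtain ⟨δ, hδ0, hδ⟩ := EReal.lt_iff_exists_real_btwn.1 hb
  have hle : 𝓝[<] a ≤ leftOf (a : EReal) := by
    rw [leftOf, ← map_le_iff_le_comap]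
    refine tendsto_nhdsWithin_iff.2
      ⟨continuous_coe_real_ereal.continuousAt.tendsto.mono_left nhdsWithin_le_nhds, ?_⟩
    exact eventually_nhdsWithin_of_forall fun x hx => EReal.coe_lt_coe_iff.2 hx
  obtain ⟨c, hc, hsub⟩ :=
    mem_nhdsLT_iff_exists_Ioo_subset.1 (hle (eventually_lt_of_lt_liminf hδ))
  refine ⟨a - c, δ, sub_pos.2 hc, EReal.coe_pos.1 hδ0, fun x hx hxa => ?_⟩
  rw [sub_sub_cancel] at hx
  exact EReal.coe_le_coe_iff.1 (le_of_lt (hsub ⟨hx, hxa⟩))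

theorem exists_pos_forall_mul_exp_neg_lt {b c ε : ℝ} (hc : 0 < c) (hε : 0 < ε) :
    ∃ T₀, 0 < T₀ ∧ ∀ t, T₀ ≤ t → b * Real.exp (-(c * t)) < ε := by
  have hlim : Tendsto (fun t => b * Real.exp (-(c * t))) atTop (𝓝 (b * 0)) :=
    (Real.tendsto_exp_neg_atTop_nhds_zero.comp (tendsto_id.const_mul_atTop hc)).const_mul _
  rw [mul_zero] at hlim
  exact ((eventually_gt_atTop 0).and
    (eventually_forall_ge_atTop.2 (hlim.eventually_lt_const hε))).exists

theorem exists_pos_mul_le {a k T₀ : ℝ} (ha : 0 < a) (hk : 0 < k) (hT₀ : 0 < T₀) :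
    ∃ C, 0 < C ∧ ∀ T Λ, 0 < T → a ≤ Λ → (T₀ ≤ T → k * (T - T₀) ≤ Λ) → C * T ≤ Λ := by
  refine ⟨min (a / (2 * T₀)) (k / 2), by positivity, fun T Λ hT hle hlate => ?_⟩
  rcases le_total T (2 * T₀) with h | h
  · calc min (a / (2 * T₀)) (k / 2) * T ≤ a / (2 * T₀) * (2 * T₀) := by
          gcongr
          exact min_le_left _ _
      _ = a := div_mul_cancel₀ a (by positivity)
      _ ≤ Λ := hle
  · have hmin := mul_le_mul_of_nonneg_right (min_le_right (a / (2 * T₀)) (k / 2)) hT.le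
    have hhalf := mul_le_mul_of_nonneg_left h hk.le
    linarith [hlate (by linarith)]

theorem proposition4p3_general (A : EReal) (b : ℝ → ℝ) (hb : ∀ x ∈ interval A, b x ≤ 1 / 2)
    (hlim : 0 < liminf (fun x : ℝ => (b x : EReal)) (leftOf A)) :
    ∃ C : ℝ, 0 < C ∧
      ∀ w₀ : ℝ → ℝ, ContDiffOn ℝ 2 (tail w₀) (interval A) → supportEnd w₀ = A →
        (∀ x ∈ interval A, beta w₀ x = b x) →
        ∀ w : ℝ → ℝ → ℝ, IsSolution w₀ w → ∀ T : ℝ, 0 < T → C * T ≤ meanVolume w T := by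
  have hstar : ∀ w₀ w, IsSolution w₀ w → ContDiffOn ℝ 2 (tail w₀) (interval A) →
      supportEnd w₀ = A → (∀ x ∈ interval A, beta w₀ x = b x) → IsStarConcave w₀ := by
    rintro w₀ w h hC rfl hβ
    exact h.isProfile_initial.isStarConcave hC fun x hx => (hβ x hx).trans_le (hb x hx)
  by_cases hA : ∃ a : ℝ, 0 < a ∧ A = a
  · obtain ⟨a, ha, rfl⟩ := hA
    obtain ⟨ε, δ, hε, hδ, hbδ⟩ := exists_pos_forall_le_of_liminf hlim
    obtain ⟨T₀, hT₀, hlate⟩ := exists_pos_forall_mul_exp_neg_lt (b := 2 * a)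
      (show 0 < ε / a ^ 2 / 18 by positivity) hε
    obtain ⟨C, hC, hCT⟩ := exists_pos_mul_le (half_pos ha)
      (show 0 < δ / (4 * Real.exp 6) by positivity) hT₀
    refine ⟨C, hC, fun w₀ hC₂ hend hβ w h T hT => ?_⟩
    have hs := hstar w₀ w h hC₂ hend hβ
    have hdecay : HasEndDecay w₀ a ε δ :=
      h.isProfile_initial.hasEndDecay (hend ▸ hC₂) hend hδ.le
        fun x hx hax hxa => (hbδ x hax hxa).trans_eq (hβ x ⟨hx.le, EReal.coe_lt_coe hxa⟩).symm
    exact hCT T _ hT (h.half_supportEnd_le_meanVolume hs hend hT)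
      (h.mul_sub_le_meanVolume hs hend hδ.le hdecay hT₀ hlate)
  · refine ⟨1, one_pos, fun w₀ hC₂ hend hβ w h => absurd ?_ hA⟩
    exact hend ▸ h.isProfile_initial.exists_supportEnd_eq (hstar w₀ w h hC₂ hend hβ)

end LSW

theorem proposition4p3 :
    ∃ βmax : ℝ, 0 < βmax ∧
      -- the beta function `b` of the initial data, with its domain `[0, a)`
      ∀ (a : EReal) (b : ℝ → ℝ),
        (∀ x ∈ LSW.interval a, b x ≤ βmax) →
        0 < Filter.liminf (fun x : ℝ => (b x : EReal)) (LSW.leftOf a) →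
        -- the constant depends only on this beta function
        ∃ C : ℝ, 0 < C ∧
          ∀ w₀ : ℝ → ℝ, LSW.IsInitialDatum w₀ →
            LSW.supportEnd w₀ = a →
            (∀ x ∈ LSW.interval a, LSW.beta w₀ x = b x) →
            ∀ w : ℝ → ℝ → ℝ, LSW.IsSolution w₀ w →
              ∀ T : ℝ, 1 ≤ T → C * T ≤ LSW.meanVolume w T := by
  refine ⟨1 / 2, by norm_num, fun a b hb hlim => ?_⟩
  obtain ⟨C, hC, hgrowth⟩ := LSW.proposition4p3_general a b hb hlim
  exact ⟨C, hC, fun w₀ hw₀ hend hβ w h T hT =>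
    hgrowth w₀ (hend ▸ hw₀.contDiffOn_tail) hend hβ w h T (one_pos.trans_le hT)⟩
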